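/- Let $G=(X,Y,E)$ be a nonempty finite bipartite graph with positive integer edge weights $w(u,v)$ (put $w(u,v)=0$ if $u,v$ are not adjacent), with $n$ nodes, $m$ edges and total weight $W$, where $m=\Omega(n)$. For a graph $H$ let $\mathrm{mwm}(H)$ be the largest total weight of a matching (a set of pairwise node-disjoint edges) of $H$, and let $M$ be a matching of $G$ of weight $\mathrm{mwm}(G)$. The unfolded graph $\phi(G)$ has, for each node $u$ of $G$, the nodes $u^1,\dots,u^{\alpha(u)}$, where $\alpha(u)$ is the weight of the heaviest edge at $u$ ($\alpha(u)=0$ if $u$ is isolated), and, for each edge $uv$ of $G$ of weight $\beta$, the edges $u^1v^{\beta},u^2v^{\beta-1},\dots,u^{\beta}v^1$. Let $\phi(M)$ be the matching of $\phi(G)$ that consists of those of these edges that come from edges $uv\in M$. A path in $\phi(G)$ is alternating for $\phi(M)$ if its edges alternate between being in $\phi(M)$ and not being in $\phi(M)$ and if, whenever its first (last) node is matched by $\phi(M)$, its first (last) edge is in $\phi(M)$; in particular, a path of length $0$ is alternating if and only if its node is unmatched. Let $\rho(u^i)=0$ if there is an alternating path of even length for $\phi(M)$ that starts from $u^i$,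 and $\rho(u^i)=1$ otherwise. The procedure Compute-All-Cavity$(G,M)$ is the following. (1) Construct $\phi(G)$ and $\phi(M)$. (2) By a depth-first search from all nodes of $\phi(G)$ that are unmatched by $\phi(M)$, mark the reachable nodes, where the search may move from $a$ to $c$ if for some node $b$ the edge $ab$ is in $\phi(G)-\phi(M)$ and the edge $bc$ is in $\phi(M)$. (3) Record the value $0$ for each marked node $u^i$ and the value $1$ for each unmarked one. (4) For each node $u$ of $G$, output the weight of $M$ minus the sum of the values recorded for $u^1,\dots,u^{\alpha(u)}$. Theorem. On a random access machine (unit cost for addition, truncated subtraction, comparison, and register and array access; $G$ given by a list of its edges with their weights, $M$ by a mark on each of its edges, all other memory initially $0$), the procedure Compute-All-Cavity$(G,M)$ halts, the value that it records for each $u^i$ is $\rho(u^i)$, and its output for each node $u$ of $G$ is $\mathrm{mwm}(G-\{u\})$. Its total running time is $O(W)$: for every $a$ there is a constant $\kappa$ such that it takes at most $\kappa W$ steps on all such $G$ and $M$ with $n\le a\,m$. -/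

import Mathlib

/-! ### Weighted bipartite graphs and matchings -/

/-- A bipartite graph with node classes `X`, `Y` and positive integer edge weights. As usual, it is
given by its weight function, which is `0` exactly at the non-adjacent pairs. -/
structure WBGraph (X Y : Type*) where
  /-- the weight of the edge `xy`, and `0` if `x` and `y` are not adjacent -/
  weight : X → Y → ℕ

namespace WBGraph

section Basic

variable {X Y : Type*} (G : WBGraph X Y)

/-- A matching: a set of pairwise node-disjoint edges of `G`. -/
def IsMatching (M : Finset (X × Y)) : Prop :=
  (∀ e ∈ M, 0 < G.weight e.1 e.2) ∧
    ∀ e ∈ M, ∀ f ∈ M, e ≠ f → e.1 ≠ f.1 ∧ e.2 ≠ f.2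

/-- The total weight of a set of edges. -/
def setWeight (M : Finset (X × Y)) : ℕ := ∑ e ∈ M, G.weight e.1 e.2

/-- The graph `G - {u}`, obtained by deleting the node `u` and all edges incident to it. -/
def deleteNode (u : X ⊕ Y) : WBGraph {x : X // Sum.inl x ≠ u} {y : Y // Sum.inr y ≠ u} where
  weight x y := G.weight x y

/-- The weight `w(u, v)` for arbitrary nodes `u, v`, and `0` if they are not adjacent. -/
def nodeWeight : X ⊕ Y → X ⊕ Y → ℕ
  | Sum.inl x, Sum.inr y => G.weight x y
  | Sum.inr y, Sum.inl x => G.weight x y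
  | _, _ => 0

variable [Fintype X] [Fintype Y]

/-- `W`, the total weight of `G`. -/
def totalWeight : ℕ := ∑ x, ∑ y, G.weight x y

open Classical in
/-- `mwm(G)`, the maximum weight of a matching of `G`. -/
noncomputable def mwm : ℕ :=
  (Finset.univ.filter fun M : Finset (X × Y) => G.IsMatching M).sup G.setWeight

/-- `M` is a maximum weight matching of `G`. -/
def IsMaxWeightMatching (M : Finset (X × Y)) : Prop :=
  G.IsMatching M ∧ G.setWeight M = G.mwm

/-! ### The unfolded graph and alternating paths -/

/-- The weight of the heaviest edge incident to a node (`0` for an isolated node). -/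
def heaviest (u : X ⊕ Y) : ℕ := Finset.univ.sup (G.nodeWeight u)

/-- The nodes of the unfolded graph: `heaviest u` copies of each node `u`. The copies are counted
from `0` here, so that `⟨u, i⟩` is the copy usually written with the superscript `i + 1`. -/
abbrev Copy : Type _ := Σ u : X ⊕ Y, Fin (G.heaviest u)

/-- The unfolded graph: an edge `uv` of weight `β` gives the edges between the `i`-th copy of `u`
and the `j`-th copy of `v` with `i + j = β + 1` (copies counted from `1`), that is, with
`i + j + 1 = β` (copies counted from `0`). -/
def unfold : SimpleGraph G.Copy where
  Adj a b := (a.2 : ℕ) + (b.2 : ℕ) + 1 = G.nodeWeight a.1 b.1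
  symm := ⟨by
    rintro ⟨u | u, i⟩ ⟨v | v, j⟩ h <;> simp only [nodeWeight] at h ⊢ <;> omega⟩
  loopless := ⟨by
    rintro ⟨u | u, i⟩ h <;> simp only [nodeWeight] at h <;> omega⟩

/-- The unfolding of a set of edges `M` of `G`, as a set of edges of the unfolded graph: the edges
of the unfolded graph that come from an edge in `M`. -/
def unfoldEdges (M : Finset (X × Y)) : Set (Sym2 G.Copy) :=
  {f | f ∈ G.unfold.edgeSet ∧ ∃ a b : G.Copy, f = s(a, b) ∧
    ∃ x y, (x, y) ∈ M ∧ a.1 = Sum.inl x ∧ b.1 = Sum.inr y}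

/-- The node `a` of a graph is matched by the set of edges `F`. -/
def MatchedBy {V : Type*} (F : Set (Sym2 V)) (a : V) : Prop := ∃ e ∈ F, a ∈ e

/-- A path of a graph `H` from `a` to `b` is alternating for the matching `F` if its edges alternate
between being in `F` and not being in `F`, and if it contains the matched edge of its first (last)
node as its first (last) edge in case that node is matched by `F`. -/
def IsAlternating {V : Type*} {H : SimpleGraph V} (F : Set (Sym2 V)) {a b : V}
    (p : H.Walk a b) : Prop :=
  p.IsPath ∧ p.edges.IsChain (fun e f => e ∈ F ↔ f ∉ F) ∧
    (MatchedBy F a → ∃ e ∈ p.edges.head?, e ∈ F) ∧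
    (MatchedBy F b → ∃ e ∈ p.edges.getLast?, e ∈ F)

open Classical in
/-- `ρ(a)` for a node `a` of the unfolded graph: `0` if some alternating path for the unfolding
of `M` that starts from `a` has even length, and `1` otherwise. -/
noncomputable def rho (M : Finset (X × Y)) (a : G.Copy) : ℕ :=
  if ∃ (b : G.Copy) (p : G.unfold.Walk a b),
    IsAlternating (G.unfoldEdges M) p ∧ Even p.length then 0 else 1

end Basic

end WBGraph

/-! ### A random access machine with a step count

Programs are structured programs over finitely many registers `R` and arrays `A` that hold natural
numbers. Every operation (constant, register access, array access, addition, truncated subtraction,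
comparison, assignment, test) takes one step. -/

namespace RAM

/-- Expressions. -/
inductive Expr (R A : Type) where
  | num (k : ℕ)
  | reg (r : R)
  | get (a : A) (i : Expr R A)
  | add (e f : Expr R A)
  | sub (e f : Expr R A)
  | lt (e f : Expr R A)

/-- Commands. -/
inductive Cmd (R A : Type) where
  | assign (r : R) (e : Expr R A)
  | store (a : A) (i e : Expr R A)
  | seq (c d : Cmd R A)
  | ite (e : Expr R A) (c d : Cmd R A)
  | skip
  | while (e : Expr R A) (c : Cmd R A)

/-- The contents of the registers and of the arrays. -/
structure State (R A : Type) where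
  reg : R → ℕ
  arr : A → ℕ → ℕ

variable {R A : Type}

/-- The value of an expression; a comparison has the value `1` if it is true and `0` otherwise. -/
def Expr.eval (s : State R A) : Expr R A → ℕ
  | .num k => k
  | .reg r => s.reg r
  | .get a i => s.arr a (i.eval s)
  | .add e f => e.eval s + f.eval s
  | .sub e f => e.eval s - f.eval s
  | .lt e f => if e.eval s < f.eval s then 1 else 0

/-- The number of steps in the evaluation of an expression, one for each operation in it. -/
def Expr.cost : Expr R A → ℕ
  | .num _ => 1
  | .reg _ => 1
  | .get _ i => i.cost + 1
  | .add e f => e.cost + f.cost + 1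
  | .sub e f => e.cost + f.cost + 1
  | .lt e f => e.cost + f.cost + 1

/-- Write a register. -/
def State.setReg [DecidableEq R] (s : State R A) (r : R) (k : ℕ) : State R A :=
  { s with reg := Function.update s.reg r k }

/-- Write an array entry. -/
def State.setArr [DecidableEq A] (s : State R A) (a : A) (i k : ℕ) : State R A :=
  { s with arr := Function.update s.arr a (Function.update (s.arr a) i k) }

/-- `Exec c s s' t`: the command `c`, started in the state `s`, halts in the state `s'` after exactly
`t` steps. In tests, a value other than `0` counts as true. -/
inductive Exec [DecidableEq R] [DecidableEq A] :
    Cmd R A → State R A → State R A → ℕ → Prop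
  | assign (r e s) : Exec (.assign r e) s (s.setReg r (e.eval s)) (e.cost + 1)
  | store (a i e s) :
      Exec (.store a i e) s (s.setArr a (i.eval s) (e.eval s)) (i.cost + e.cost + 1)
  | seq {c d s₁ s₂ s₃ t₁ t₂} :
      Exec c s₁ s₂ t₁ → Exec d s₂ s₃ t₂ → Exec (.seq c d) s₁ s₃ (t₁ + t₂)
  | ite_true {e c d s s' t} :
      e.eval s ≠ 0 → Exec c s s' t → Exec (.ite e c d) s s' (e.cost + 1 + t)
  | ite_false {e c d s s' t} :
      e.eval s = 0 → Exec d s s' t → Exec (.ite e c d) s s' (e.cost + 1 + t)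
  | skip (s) : Exec .skip s s 1
  | while_true {e c s₁ s₂ s₃ t₁ t₂} :
      e.eval s₁ ≠ 0 → Exec c s₁ s₂ t₁ → Exec (.while e c) s₂ s₃ t₂ →
        Exec (.while e c) s₁ s₃ (e.cost + 1 + t₁ + t₂)
  | while_false {e c s} :
      e.eval s = 0 → Exec (.while e c) s s (e.cost + 1)

instance : Add (Expr R A) := ⟨Expr.add⟩

instance : Sub (Expr R A) := ⟨Expr.sub⟩

instance (k : ℕ) : OfNat (Expr R A) k := ⟨Expr.num k⟩

end RAM

infixr:30 " ;; " => RAM.Cmd.seq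

infix:40 " ≔ " => RAM.Cmd.assign

infix:50 " ≺ " => RAM.Expr.lt

/-! ### The procedure Compute-All-Cavity -/

namespace AllCavity

open RAM

/-- The registers; `nx`, `ny` and `m` hold input. -/
inductive Reg where
  | nx | ny | m
  | e | i | v | x | y | w | a | b | c | k | arcs | sp | sum | tot
  deriving DecidableEq

/-- The arrays; `ex`, `ey`, `ew` and `em` hold input, and `cav` holds the output. -/
inductive Arr where
  | ex | ey | ew | em
  | height | off | head | next | dest | mate | rho | stack | cav
  deriving DecidableEq

/-- The value of a register. -/
abbrev r (x : Reg) : Expr Reg Arr := .reg x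

/-- `for i = 0, 1, …, bound - 1 do body` -/
def forLoop (i : Reg) (bound : Expr Reg Arr) (body : Cmd Reg Arr) : Cmd Reg Arr :=
  i ≔ 0 ;;
  .while (r i ≺ bound) (
    body ;;
    i ≔ r i + 1)

/-- Set `height[u]` to the weight of the heaviest edge at `u`, for all nodes `u` of `G`. The nodes
in `X` have the numbers `0, …, nx - 1` and those in `Y` the numbers `nx, …, nx + ny - 1`. -/
def findHeights : Cmd Reg Arr :=
  forLoop .e (r .m) (
    .ite (.get .height (.get .ex (r .e)) ≺ .get .ew (r .e))
      (.store .height (.get .ex (r .e)) (.get .ew (r .e))) .skip ;;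
    .ite (.get .height (r .nx + .get .ey (r .e)) ≺ .get .ew (r .e))
      (.store .height (r .nx + .get .ey (r .e)) (.get .ew (r .e))) .skip)

/-- Number the copies of the nodes: the copies of `u` get the numbers
`off[u], …, off[u] + height[u] - 1`. -/
def numberCopies : Cmd Reg Arr :=
  forLoop .v (r .nx + r .ny) (
    .store .off (r .v + 1) (.get .off (r .v) + .get .height (r .v)))

/-- Put the node in the register `b` in front of the adjacency list of the node in the register `a`.
Adjacency lists are linked lists, the list of `a` starts at `head[a]`, and `0` ends a list. -/
def addArc (a b : Reg) : Cmd Reg Arr :=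
  .arcs ≔ r .arcs + 1 ;;
  .store .dest (r .arcs) (r b) ;;
  .store .next (r .arcs) (.get .head (r a)) ;;
  .store .head (r a) (r .arcs)

/-- Construct the unfolded graph (in adjacency lists) and the unfolded matching (in the array
`mate`: `mate[a]` is `0` if `a` is unmatched, and is `b + 1` if `a` is matched to `b`). -/
def unfoldGraph : Cmd Reg Arr :=
  findHeights ;;
  numberCopies ;;
  forLoop .e (r .m) (
    .x ≔ .get .off (.get .ex (r .e)) ;;
    .y ≔ .get .off (r .nx + .get .ey (r .e)) ;;
    .w ≔ .get .ew (r .e) ;;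
    forLoop .i (r .w) (
      .a ≔ r .x + r .i ;;
      .b ≔ r .y + (r .w - (r .i + 1)) ;;
      addArc .a .b ;;
      addArc .b .a ;;
      .ite (.get .em (r .e))
        (.store .mate (r .a) (r .b + 1) ;;
         .store .mate (r .b) (r .a + 1))
        .skip))

/-- Push the node `e` on the stack. -/
def push (e : Expr Reg Arr) : Cmd Reg Arr :=
  .store .stack (r .sp) e ;;
  .sp ≔ r .sp + 1

/-- Compute the array `rho` by a depth-first search from all unmatched nodes of the unfolded graph.
The search moves from `a` to `c` if there is a node `b` such that `ab` is an edge outside the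
unfolded matching and `bc` is an edge in it. (If `ab` is in the matching, then `c = a` is already
marked.) The reached nodes are marked by the value `0`. -/
def search : Cmd Reg Arr :=
  forLoop .v (.get .off (r .nx + r .ny)) (
    .ite (.get .mate (r .v))
      (.store .rho (r .v) 1)
      (push (r .v))) ;;
  .while (r .sp) (
    .a ≔ .get .stack (r .sp - 1) ;;
    .k ≔ .get .head (r .a) ;;
    .ite (r .k)
      (.store .head (r .a) (.get .next (r .k)) ;;
       .b ≔ .get .dest (r .k) ;;
       .ite (.get .mate (r .b))
        (.c ≔ .get .mate (r .b) - 1 ;;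
         .ite (.get .rho (r .c))
          (.store .rho (r .c) 0 ;;
           push (r .c))
          .skip)
        .skip)
      (.sp ≔ r .sp - 1))

/-- Compute the weight of the given matching and, for each node `u` of `G`, subtract from it the
sum of the values `rho` of the copies of `u`. -/
def output : Cmd Reg Arr :=
  forLoop .e (r .m) (
    .ite (.get .em (r .e)) (.tot ≔ r .tot + .get .ew (r .e)) .skip) ;;
  forLoop .v (r .nx + r .ny) (
    .sum ≔ 0 ;;
    forLoop .i (.get .height (r .v)) (
      .sum ≔ r .sum + .get .rho (.get .off (r .v) + r .i)) ;;
    .store .cav (r .v) (r .tot - r .sum))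

/-- The procedure Compute-All-Cavity. -/
def computeAllCavity : Cmd Reg Arr :=
  unfoldGraph ;;
  search ;;
  output

/-- The number of a node. -/
def nodeNumber {p q : ℕ} : Fin p ⊕ Fin q → ℕ
  | Sum.inl x => x
  | Sum.inr y => p + y

/-- The initial state for the graph `G` with node classes of `p` and `q` nodes, with edge list `l`,
and for the set `M` of edges: the `j`-th edge `xy` of the list is stored by its ends `ex[j] = x` and
`ey[j] = y`, its weight `ew[j]` and a bit `em[j]` that tells whether it is in `M`. All other
registers and array entries are `0`. -/
def input {p q : ℕ} (G : WBGraph (Fin p) (Fin q)) (l : List (Fin p × Fin q))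
    (M : Finset (Fin p × Fin q)) : State Reg Arr where
  reg
    | .nx => p
    | .ny => q
    | .m => l.length
    | _ => 0
  arr
    | .ex => fun j => (l.map fun e => (e.1 : ℕ)).getD j 0
    | .ey => fun j => (l.map fun e => (e.2 : ℕ)).getD j 0
    | .ew => fun j => (l.map fun e => G.weight e.1 e.2).getD j 0
    | .em => fun j => (l.map fun e => if e ∈ M then 1 else 0).getD j 0
    | _ => fun _ => 0

end AllCavity

set_option linter.constructorNameAsVariable false
set_option linter.unusedSectionVars false

/-! The proof is integral duality between matchings and covers. A cover gives every node a natural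
number such that each edge weighs at most the sum of its two ends. Its total is an upper bound for
the weight of every matching, and a cover whose total is at most w(M) is tight on M and zero off M
(`IsCover.tight`). The loss mwm(G) - mwm(G-u) and the sum of ρ over the copies of u are compared
through two such covers.

Loss ≤ sum of ρ. Egerváry's theorem with lower bounds (`exists_cover_tight_matching`), with the loss
prescribed as lower bound at u, gives a cover c of total at most mwm(G) with c(u) at least the loss
(`exists_cover_sum_le_mwm`). For every v take the copies of v numbered below c(v), counting from 0.
They form a node cover of φ(G) that contains exactly one end of each edge of φ(M) and no unmatched
copy. Hence the search never enters this set (`EvenReachable.le`), and at least c(u) copies of u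
have ρ = 1.

Sum of ρ ≤ loss. As in König's theorem, take the unreachable copies on the side of u and the
neighbours of reachable copies on the other side. This is a node cover of φ(G). It consists of
matched copies, because c excludes augmenting paths, and contains at most one end of each edge of
φ(M). Counting its copies at each node gives a cover of G of total at most w(M) whose value at u is
the sum of ρ. A matching of G-u leaves this value unused, so mwm(G-u) plus the sum is at most w(M)
(`mwm_deleteNode_add_sum_rho`).

That ρ = 0 means reachability uses bipartiteness, which lets alternating walks be cut down to paths
(`rho_eq_zero_iff`).

For the machine, every loop has an invariant. φ(G) has at most 2W nodes (`sum_heaviest_le`) and W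
edges, and each round of the search lowers the potential "arcs left + stack height + unmarked
nodes". All phases together take O(n + m + W) steps, which is O(W) because m ≤ W and n ≤ a m. -/

namespace WBGraph

/-! ### Weighted covers and Egerváry's theorem with lower bounds. -/

section Covers

variable {X Y : Type*} (G : WBGraph X Y)

/-- A weighted node cover: every edge weighs at most the sum of the values of its ends. -/
def IsCover (c : X ⊕ Y → ℕ) : Prop :=
  ∀ x y, G.weight x y ≤ c (.inl x) + c (.inr y)

/-- The node `v` is an end of an edge in `M`. -/
def Covers (M : Finset (X × Y)) (v : X ⊕ Y) : Prop :=
  ∃ e ∈ M, v = .inl e.1 ∨ v = .inr e.2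

variable [Fintype X] [Fintype Y]

/-- In a minimum cover above given lower bounds, shifting one unit from `D` to the tight neighbours
of `D` does not reduce the total. -/
theorem card_le_card_of_minimal_cover {G : WBGraph X Y} {l c : X ⊕ Y → ℕ} (hl : l ≤ c)
    (hc : G.IsCover c) (hmin : ∀ c', l ≤ c' → G.IsCover c' → ∑ v, c v ≤ ∑ v, c' v)
    (D E : Finset (X ⊕ Y)) (hD : ∀ v ∈ D, l v < c v)
    (hside : ∀ x y, ¬ (.inl x ∈ D ∧ .inr y ∈ D))
    (hE : ∀ x y, G.weight x y = c (.inl x) + c (.inr y) →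
      (.inl x ∈ D → .inr y ∈ E) ∧ (.inr y ∈ D → .inl x ∈ E)) :
    D.card ≤ E.card := by
  classical
  -- Lowering `D` and raising `E` by one keeps a cover: by `hside` an edge loses at most one unit,
  -- which a slack edge can spare and which `E` restores on a tight edge.
  have key := hmin (fun v => c v - (if v ∈ D then 1 else 0) + (if v ∈ E then 1 else 0)) ?_ ?_
  · have h1 : ∑ v, (c v - (if v ∈ D then 1 else 0) + (if v ∈ E then 1 else 0)) + D.card
        = ∑ v, c v + E.card := by
      have hcard : ∀ S : Finset (X ⊕ Y), S.card = ∑ v, if v ∈ S then 1 else 0 := by simp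
      rw [hcard D, hcard E, ← Finset.sum_add_distrib, ← Finset.sum_add_distrib]
      refine Finset.sum_congr rfl fun v _ => ?_
      by_cases h : v ∈ D
      · have := hD v h
        simp only [h, if_true]
        omega
      · simp [h]
    omega
  · intro v
    have := hl v
    by_cases h : v ∈ D
    · have := hD v h
      simp only [h, if_true]
      omega
    · simp only [h, if_false]
      exact le_add_right this
  · intro x y
    have h1 := hc x y
    have h2 := hside x y
    have h3 := hE x y
    by_cases hx : Sum.inl x ∈ D <;> by_cases hy : Sum.inr y ∈ D <;>
      by_cases hx' : Sum.inl x ∈ E <;> by_cases hy' : Sum.inr y ∈ E <;>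
      simp only [hx, hy, hx', hy', if_true, if_false] <;> simp [hx, hy, hx', hy'] at h2 h3 <;> omega

theorem exists_minimal_cover (l : X ⊕ Y → ℕ) :
    ∃ c, l ≤ c ∧ G.IsCover c ∧
      ∀ c', l ≤ c' → G.IsCover c' → ∑ v, c v ≤ ∑ v, c' v := by
  obtain ⟨c, ⟨h1, h2⟩, h3⟩ := WellFounded.has_min
    (measure fun c : X ⊕ Y → ℕ => ∑ v, c v).wf {c | l ≤ c ∧ G.IsCover c}
    -- Some cover above `l` exists: no edge weighs more than the total weight.
    ⟨fun v => l v + G.totalWeight, fun v => Nat.le_add_right _ _, fun x y => by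
      have h1 : G.weight x y ≤ ∑ y, G.weight x y :=
        Finset.single_le_sum (f := fun y => G.weight x y) (fun _ _ => Nat.zero_le _)
          (Finset.mem_univ y)
      have h2 : ∑ y, G.weight x y ≤ G.totalWeight :=
        Finset.single_le_sum (f := fun x => ∑ y, G.weight x y) (fun _ _ => Nat.zero_le _)
          (Finset.mem_univ x)
      dsimp only
      omega⟩
  exact ⟨c, h1, h2, fun c' a b => not_lt.1 fun h => h3 c' ⟨a, b⟩ h⟩

/-- Egerváry's theorem with lower bounds: some cover above `l` is tight on a matching that covers
all nodes at which the cover exceeds `l`. -/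
theorem exists_cover_tight_matching (l : X ⊕ Y → ℕ) :
    ∃ c, l ≤ c ∧ G.IsCover c ∧ ∃ M : Finset (X × Y), G.IsMatching M ∧
      (∀ e ∈ M, G.weight e.1 e.2 = c (.inl e.1) + c (.inr e.2)) ∧
      ∀ v, l v < c v → Covers M v := by
  classical
  obtain ⟨c, hl, hc, hmin⟩ := G.exists_minimal_cover l
  have exch := card_le_card_of_minimal_cover hl hc hmin
  let T (x : X) : Finset Y := {y | G.weight x y = c (.inl x) + c (.inr y)}
  have hT : ∀ x y, y ∈ T x ↔ G.weight x y = c (.inl x) + c (.inr y) := by simp [T]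
  -- Hall's theorem with dummies on both sides. A node `x` may take a tight neighbour, or its own
  -- dummy `inr x` if it does not exceed `l`. The dummy of `y` may take `y` if `y` does not exceed
  -- `l`, or any dummy of a node in `X`.
  let t : X ⊕ Y → Finset (Y ⊕ X) := Sum.elim
    (fun x => (T x).disjSum (if c (.inl x) = l (.inl x) then {x} else ∅))
    (fun y => Finset.disjSum (if c (.inr y) = l (.inr y) then {y} else ∅) Finset.univ)
  obtain ⟨f, hf, hft⟩ := (Finset.all_card_le_biUnion_card_iff_exists_injective t).1 (by
    intro s
    obtain ⟨A, B, rfl⟩ : ∃ A B, s = Finset.disjSum A B :=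
      ⟨s.toLeft, s.toRight, s.toLeft_disjSum_toRight.symm⟩
    rw [Finset.card_disjSum]
    rcases B.eq_empty_or_nonempty with rfl | ⟨y₀, hy₀⟩
    -- Without dummies of `Y`, the nodes of `A` at their lower bound use their own dummies, and the
    -- exchange argument gives the others enough tight neighbours.
    · have hsub : ((A.filter fun x => l (.inl x) < c (.inl x)).biUnion T).disjSum
          (A.filter fun x => ¬ l (.inl x) < c (.inl x)) ⊆ (A.disjSum ∅).biUnion t := by
        intro z hz
        rw [Finset.mem_biUnion]
        rcases z with y | x
        · simp only [Finset.inl_mem_disjSum, Finset.mem_biUnion, Finset.mem_filter] at hz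
          obtain ⟨x, ⟨hx, -⟩, hy⟩ := hz
          exact ⟨.inl x, by simpa using hx, by simpa [t] using hy⟩
        · simp only [Finset.inr_mem_disjSum, Finset.mem_filter] at hz
          have := (hl (.inl x)).antisymm (not_lt.1 hz.2)
          exact ⟨.inl x, by simpa using hz.1, by simp [t, this]⟩
      have h1 := Finset.card_le_card hsub
      rw [Finset.card_disjSum] at h1
      have h2 := exch ((A.filter fun x => l (.inl x) < c (.inl x)).disjSum ∅)
        (Finset.disjSum ∅ ((A.filter fun x => l (.inl x) < c (.inl x)).biUnion T))
        (by
          rintro (x | y) h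
          · simp at h; exact h.2
          · simp at h)
        (by simp)
        (by
          intro x y h
          simp only [Finset.inl_mem_disjSum, Finset.inr_mem_disjSum, Finset.mem_biUnion,
            Finset.notMem_empty, false_imp_iff, and_true]
          exact fun hx => ⟨x, hx, (hT x y).2 h⟩)
      rw [Finset.card_disjSum, Finset.card_disjSum] at h2
      have h3 := Finset.card_filter_add_card_filter_not (s := A)
        fun x => l (.inl x) < c (.inl x)
      simp only [Finset.card_empty] at h2 ⊢
      omega
    -- One dummy of `Y` already sees all dummies of `X`. It remains to see that the nodes of `B`
    -- outside the neighbourhood are at most as many as the nodes outside `A`; their tight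
    -- neighbours all lie outside `A`, so the exchange argument applies again.
    · have hsub : (A.biUnion T ∪ B.filter fun y => ¬ l (.inr y) < c (.inr y)).disjSum
          (Finset.univ : Finset X) ⊆ (A.disjSum B).biUnion t := by
        intro z hz
        rw [Finset.mem_biUnion]
        rcases z with y | x
        · simp only [Finset.inl_mem_disjSum, Finset.mem_union, Finset.mem_biUnion,
            Finset.mem_filter] at hz
          rcases hz with ⟨x, hx, hy⟩ | ⟨hy, h⟩
          · exact ⟨.inl x, by simpa using hx, by simpa [t] using hy⟩
          · have := (hl (.inr y)).antisymm (not_lt.1 h)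
            exact ⟨.inr y, by simpa using hy, by simp [t, this]⟩
        · exact ⟨.inr y₀, by simpa using hy₀, by simp [t]⟩
      have h1 := Finset.card_le_card hsub
      rw [Finset.card_disjSum, Finset.card_univ] at h1
      let N := A.biUnion T ∪ B.filter fun y => ¬ l (.inr y) < c (.inr y)
      have h2 := exch (Finset.disjSum ∅ (B \ N)) (Finset.disjSum Aᶜ ∅)
        (by
          rintro (x | y) h
          · simp at h
          · simp only [Finset.inr_mem_disjSum, Finset.mem_sdiff, N, Finset.mem_union,
              Finset.mem_filter, not_or, not_and, not_not] at h
            exact h.2.2 h.1)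
        (by simp)
        (by
          intro x y h
          simp only [Finset.inl_mem_disjSum, Finset.inr_mem_disjSum, Finset.mem_sdiff,
            Finset.notMem_empty, false_imp_iff, true_and, Finset.mem_compl, N, Finset.mem_union,
            Finset.mem_biUnion, not_or, not_exists, not_and]
          exact fun hy hx => hy.2.1 x hx ((hT x y).2 h))
      rw [Finset.card_disjSum, Finset.card_disjSum, Finset.card_compl] at h2
      have h3 : B.card ≤ (B \ N).card + N.card := by
        have := Finset.le_card_sdiff N B
        omega
      have h4 := Finset.card_le_univ A
      simp only [Finset.card_empty, N] at h2 h3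
      omega)
  have hfl : ∀ x y, f (.inl x) = .inl y → G.weight x y = c (.inl x) + c (.inr y) := by
    intro x y h
    have := hft (.inl x)
    rw [h] at this
    simpa [t, hT] using this
  -- Pairs of weight 0 are not edges and are dropped. Being tight, they have value 0 at both ends,
  -- so they are not needed to cover nodes that exceed `l`.
  refine ⟨c, hl, hc, Finset.univ.filter fun e : X × Y =>
    f (.inl e.1) = .inl e.2 ∧ 0 < G.weight e.1 e.2, ⟨?_, ?_⟩, ?_, ?_⟩
  · intro e he
    exact (Finset.mem_filter.1 he).2.2
  · rintro ⟨x, y⟩ he ⟨x', y'⟩ he' hne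
    simp only [Finset.mem_filter, Finset.mem_univ, true_and] at he he'
    refine ⟨?_, ?_⟩
    · rintro rfl
      exact hne (by rw [Sum.inl.inj (he.1.symm.trans he'.1)])
    · rintro rfl
      exact hne (by rw [Sum.inl.inj (hf (he.1.trans he'.1.symm))])
  · intro e he
    exact hfl _ _ (Finset.mem_filter.1 he).2.1
  · rintro (x | y) hv
    · have h1 := hft (.inl x)
      rcases hfx : f (.inl x) with y | x'
      · have := hfl x y hfx
        exact ⟨(x, y), by simp [hfx]; omega, .inl rfl⟩
      · rw [hfx] at h1
        simp only [Sum.elim_inl, Finset.inr_mem_disjSum, t] at h1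
        rw [if_neg (by omega)] at h1
        simp at h1
    -- Both sides of `f` have |X| + |Y| elements, so `f` is onto; a `y` that exceeds `l` cannot be
    -- taken by its dummy and is taken by some `x`.
    · obtain ⟨v, hfv⟩ := ((Fintype.bijective_iff_injective_and_card f).2
        ⟨hf, by simp [add_comm]⟩).2 (.inl y)
      rcases v with x | y'
      · have := hfl x y hfv
        exact ⟨(x, y), by simp [hfv]; omega, .inr rfl⟩
      · have h1 := hft (.inr y')
        rw [hfv] at h1
        simp only [Sum.elim_inr, Finset.inl_mem_disjSum, t] at h1
        split_ifs at h1 with h2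
        · rw [Finset.mem_singleton] at h1
          subst h1
          omega
        · simp at h1

open Classical in
/-- The sum over all nodes, split into the ends of a matching and the other nodes. -/
theorem sum_eq_sum_matching {G : WBGraph X Y} {M : Finset (X × Y)} (hM : G.IsMatching M)
    (f : X ⊕ Y → ℕ) :
    ∑ v, f v = ∑ e ∈ M, (f (.inl e.1) + f (.inr e.2)) + ∑ v with ¬ Covers M v, f v := by
  rw [← Finset.sum_filter_add_sum_filter_not Finset.univ (Covers M)]
  congr 1
  have : (Finset.univ.filter (Covers M)) = (M.image Prod.fst).disjSum (M.image Prod.snd) := by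
    ext v
    rcases v with x | y <;> simp [Covers, eq_comm]
  rw [this, Finset.sum_disjSum, Finset.sum_image, Finset.sum_image, Finset.sum_add_distrib]
  · intro e he g hg h
    by_contra hne
    exact (hM.2 e he g hg hne).2 h
  · intro e he g hg h
    by_contra hne
    exact (hM.2 e he g hg hne).1 h

theorem IsMatching.setWeight_le_mwm {G : WBGraph X Y} {M : Finset (X × Y)} (hM : G.IsMatching M) :
    G.setWeight M ≤ G.mwm := by
  classical
  exact Finset.le_sup (f := G.setWeight) (by simpa using hM)

theorem exists_setWeight_eq_mwm : ∃ M, G.IsMatching M ∧ G.setWeight M = G.mwm := by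
  classical
  obtain ⟨M, hM, h⟩ := Finset.exists_mem_eq_sup
    (Finset.univ.filter fun M : Finset (X × Y) => G.IsMatching M)
    ⟨∅, by simp [IsMatching]⟩ G.setWeight
  exact ⟨M, by simpa using hM, by simp only [mwm, h]⟩

variable [DecidableEq X] [DecidableEq Y]

/-- A matching of `G - {u}` is a matching of `G` that does not cover `u`. -/
theorem exists_matching_of_deleteNode (u : X ⊕ Y) :
    ∃ M, G.IsMatching M ∧ ¬ Covers M u ∧ G.setWeight M = (G.deleteNode u).mwm := by
  obtain ⟨M, hM, h⟩ := (G.deleteNode u).exists_setWeight_eq_mwm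
  let g : {x : X // Sum.inl x ≠ u} × {y : Y // Sum.inr y ≠ u} ↪ X × Y :=
    (Function.Embedding.subtype _).prodMap (Function.Embedding.subtype _)
  refine ⟨M.map g, ⟨?_, ?_⟩, ?_, ?_⟩
  · intro e he
    obtain ⟨d, hd, rfl⟩ := Finset.mem_map.1 he
    exact hM.1 d hd
  · intro e he e' he' hne
    obtain ⟨d, hd, rfl⟩ := Finset.mem_map.1 he
    obtain ⟨d', hd', rfl⟩ := Finset.mem_map.1 he'
    have := hM.2 d hd d' hd' (fun h => hne (by rw [h]))
    exact ⟨fun h => this.1 (Subtype.ext h), fun h => this.2 (Subtype.ext h)⟩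
  · rintro ⟨e, he, h⟩
    obtain ⟨d, -, rfl⟩ := Finset.mem_map.1 he
    rcases h with h | h
    · exact d.1.2 h.symm
    · exact d.2.2 h.symm
  · rw [← h, setWeight, setWeight, Finset.sum_map]
    rfl

theorem IsMatching.setWeight_le_mwm_deleteNode {G : WBGraph X Y} {M : Finset (X × Y)}
    (hM : G.IsMatching M) {u : X ⊕ Y} (hu : ¬ Covers M u) :
    G.setWeight M ≤ (G.deleteNode u).mwm := by
  let g : {x : X // Sum.inl x ≠ u} × {y : Y // Sum.inr y ≠ u} ↪ X × Y :=
    (Function.Embedding.subtype _).prodMap (Function.Embedding.subtype _)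
  have hmem : ∀ e, e ∈ M.preimage g g.injective.injOn ↔ g e ∈ M := by simp
  have h : (G.deleteNode u).IsMatching (M.preimage g g.injective.injOn) := by
    refine ⟨fun e he => hM.1 _ ((hmem e).1 he), fun e he e' he' hne => ?_⟩
    have := hM.2 _ ((hmem e).1 he) _ ((hmem e').1 he') (fun h => hne (g.injective h))
    exact ⟨fun h => this.1 (by rw [show (g e).1 = e.1.1 from rfl, h]; rfl),
      fun h => this.2 (by rw [show (g e).2 = e.2.1 from rfl, h]; rfl)⟩
  refine le_trans (le_of_eq ?_) h.setWeight_le_mwm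
  have hmap : (M.preimage g g.injective.injOn).map g = M := by
    ext ⟨x, y⟩
    simp only [Finset.mem_map, hmem]
    constructor
    · rintro ⟨e, he, h⟩
      rwa [← h]
    · intro hxy
      have h1 : Sum.inl x ≠ u := fun h => hu ⟨_, hxy, .inl h.symm⟩
      have h2 : Sum.inr y ≠ u := fun h => hu ⟨_, hxy, .inr h.symm⟩
      exact ⟨(⟨x, h1⟩, ⟨y, h2⟩), hxy, rfl⟩
  conv_lhs => rw [← hmap, setWeight, Finset.sum_map]
  rfl

open Classical in
/-- Some cover of minimum total has at `u` at least the loss that the deletion of `u` causes. -/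
theorem exists_cover_sum_le_mwm (u : X ⊕ Y) :
    ∃ c, G.IsCover c ∧ ∑ v, c v ≤ G.mwm ∧ G.mwm ≤ (G.deleteNode u).mwm + c u := by
  -- The lower bound is the loss at `u` and 0 elsewhere.
  obtain ⟨c, hl, hc, M, hM, ht, hcov⟩ := G.exists_cover_tight_matching
    (fun v => if v = u then G.mwm - (G.deleteNode u).mwm else 0)
  refine ⟨c, hc, ?_, ?_⟩
  · have hw : G.setWeight M = ∑ e ∈ M, (c (.inl e.1) + c (.inr e.2)) := Finset.sum_congr rfl ht
    have hle : (G.deleteNode u).mwm ≤ G.mwm := by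
      obtain ⟨M', h1, -, h2⟩ := G.exists_matching_of_deleteNode u
      rw [← h2]
      exact h1.setWeight_le_mwm
    rw [sum_eq_sum_matching hM, ← hw]
    have h0 : ∀ v, ¬ Covers M v → c v ≤ if v = u then G.mwm - (G.deleteNode u).mwm else 0 :=
      fun v hv => not_lt.1 fun h => hv (hcov v h)
    -- If `M` covers `u`, the uncovered nodes have value 0 and the total is the weight of `M`.
    -- Otherwise `M` is a matching of `G - u`, and the value at `u` adds only the loss.
    by_cases hu : Covers M u
    · rw [Finset.sum_eq_zero, add_zero]
      · exact hM.setWeight_le_mwm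
      · intro v hv
        have h1 := (Finset.mem_filter.1 hv).2
        have := h0 v h1
        rw [if_neg (by rintro rfl; exact h1 hu)] at this
        omega
    · have h1 := hM.setWeight_le_mwm_deleteNode hu
      have h2 : ∑ v with ¬ Covers M v, c v ≤ G.mwm - (G.deleteNode u).mwm := by
        refine (Finset.sum_le_sum fun v hv => h0 v (Finset.mem_filter.1 hv).2).trans ?_
        rw [Finset.sum_ite_eq']
        split_ifs <;> simp
      omega
  · have := hl u
    simp only [if_true] at this
    omega

end Covers

end WBGraph

/-! ### Alternating paths in the unfolded graph, and ρ as reachability. -/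

namespace WBGraph

section Unfolding

variable {X Y : Type*} {G : WBGraph X Y} {M : Finset (X × Y)}

/-- `uv` is an edge in `M`, in either orientation. -/
def Joins (M : Finset (X × Y)) : X ⊕ Y → X ⊕ Y → Prop
  | .inl x, .inr y => (x, y) ∈ M
  | .inr y, .inl x => (x, y) ∈ M
  | _, _ => False

theorem Joins.symm {u v : X ⊕ Y} (h : Joins M u v) : Joins M v u := by
  rcases u with u | u <;> rcases v with v | v <;> exact h

theorem Joins.covers {u v : X ⊕ Y} (h : Joins M u v) : Covers M u := by
  rcases u with u | u <;> rcases v with v | v <;> simp only [Joins] at h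
  · exact ⟨_, h, .inl rfl⟩
  · exact ⟨_, h, .inr rfl⟩

theorem Covers.exists_joins {u : X ⊕ Y} (h : Covers M u) : ∃ v, Joins M u v := by
  obtain ⟨e, he, rfl | rfl⟩ := h
  · exact ⟨.inr e.2, he⟩
  · exact ⟨.inl e.1, he⟩

theorem IsMatching.joins_unique (hM : G.IsMatching M) {u v v' : X ⊕ Y} (h : Joins M u v)
    (h' : Joins M u v') : v = v' := by
  rcases u with u | u <;> rcases v with v | v <;> rcases v' with v' | v' <;>
    simp only [Joins] at h h' <;> by_contra hne
  · exact (hM.2 _ h _ h' (by simpa using hne)).1 rfl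
  · exact (hM.2 _ h _ h' (by simpa using hne)).2 rfl

theorem nodeWeight_comm (G : WBGraph X Y) (u v : X ⊕ Y) : G.nodeWeight u v = G.nodeWeight v u := by
  rcases u with u | u <;> rcases v with v | v <;> rfl

theorem isLeft_of_nodeWeight_pos {u v : X ⊕ Y} (h : 0 < G.nodeWeight u v) :
    v.isLeft = !u.isLeft := by
  rcases u with u | u <;> rcases v with v | v <;> simp_all [nodeWeight]

theorem IsCover.nodeWeight_le {c : X ⊕ Y → ℕ} (hc : G.IsCover c) (u v : X ⊕ Y) :
    G.nodeWeight u v ≤ c u + c v := by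
  rcases u with u | u <;> rcases v with v | v <;> simp only [nodeWeight, Nat.zero_le]
  · exact hc _ _
  · rw [add_comm]
    exact hc _ _

variable [Fintype X] [Fintype Y]

theorem nodeWeight_le_heaviest (G : WBGraph X Y) (u v : X ⊕ Y) :
    G.nodeWeight u v ≤ G.heaviest u :=
  Finset.le_sup (f := G.nodeWeight u) (Finset.mem_univ v)

theorem isLeft_of_adj {a b : G.Copy} (h : G.unfold.Adj a b) : b.1.isLeft = !a.1.isLeft :=
  isLeft_of_nodeWeight_pos (lt_of_lt_of_eq (Nat.succ_pos _) h)

theorem mem_unfoldEdges {a b : G.Copy} :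
    s(a, b) ∈ G.unfoldEdges M ↔ G.unfold.Adj a b ∧ Joins M a.1 b.1 := by
  simp only [unfoldEdges, Set.mem_ofPred_eq, SimpleGraph.mem_edgeSet, and_congr_right_iff]
  intro _
  constructor
  · rintro ⟨a', b', h, x, y, hxy, ha, hb⟩
    rcases Sym2.eq_iff.1 h with ⟨rfl, rfl⟩ | ⟨rfl, rfl⟩ <;> rw [ha, hb] <;> exact hxy
  · obtain ⟨u, i⟩ := a
    obtain ⟨v, j⟩ := b
    intro h
    rcases u with x | y <;> rcases v with x' | y' <;> simp only [Joins] at h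
    · exact ⟨_, _, rfl, _, _, h, rfl, rfl⟩
    · exact ⟨_, _, Sym2.eq_swap, _, _, h, rfl, rfl⟩

theorem matchedBy_unfoldEdges {a : G.Copy} :
    MatchedBy (G.unfoldEdges M) a ↔ ∃ b, s(a, b) ∈ G.unfoldEdges M := by
  constructor
  · rintro ⟨e, he, ha⟩
    obtain ⟨b, rfl⟩ := Sym2.mem_iff_exists.1 ha
    exact ⟨b, he⟩
  · rintro ⟨b, hb⟩
    exact ⟨_, hb, Sym2.mem_mk_left a b⟩

theorem copy_ext {a b : G.Copy} (h : a.1 = b.1) (h' : (a.2 : ℕ) = b.2) : a = b := by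
  obtain ⟨u, i⟩ := a
  obtain ⟨v, j⟩ := b
  dsimp only at h h'
  subst h
  rw [Fin.ext h']

/-- The matching determines the node of the partner, and the relation i + j + 1 = weight determines
its copy. -/
theorem IsMatching.unfoldEdges_unique (hM : G.IsMatching M) {a b b' : G.Copy}
    (h : s(a, b) ∈ G.unfoldEdges M) (h' : s(a, b') ∈ G.unfoldEdges M) : b = b' := by
  rw [mem_unfoldEdges] at h h'
  have h1 := hM.joins_unique h.2 h'.2
  have h2 : (a.2 : ℕ) + b.2 + 1 = G.nodeWeight a.1 b.1 := h.1
  have h3 : (a.2 : ℕ) + b'.2 + 1 = G.nodeWeight a.1 b'.1 := h'.1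
  have h4 := congrArg (G.nodeWeight a.1) h1
  exact copy_ext h1 (by omega)

/-- A copy is matched if its number is less than the weight of the matched edge. -/
theorem matchedBy_of_joins {u v : X ⊕ Y} (h : Joins M u v) {i : Fin (G.heaviest u)}
    (hi : (i : ℕ) < G.nodeWeight u v) : MatchedBy (G.unfoldEdges M) ⟨u, i⟩ := by
  have := G.nodeWeight_le_heaviest v u
  rw [nodeWeight_comm] at this
  refine matchedBy_unfoldEdges.2 ⟨⟨v, ⟨G.nodeWeight u v - 1 - i, by omega⟩⟩,
    mem_unfoldEdges.2 ⟨?_, h⟩⟩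
  change (i : ℕ) + (G.nodeWeight u v - 1 - i) + 1 = G.nodeWeight u v
  omega

/-- The copies that the search of the procedure has to mark. -/
inductive EvenReachable (G : WBGraph X Y) (M : Finset (X × Y)) : G.Copy → Prop
  | unmatched {a : G.Copy} : ¬ MatchedBy (G.unfoldEdges M) a → EvenReachable G M a
  | step {a b c : G.Copy} : EvenReachable G M a → G.unfold.Adj a b →
      s(b, c) ∈ G.unfoldEdges M → EvenReachable G M c

/-- An alternating path of even length to an unmatched node. -/
inductive EvenPath (G : WBGraph X Y) (M : Finset (X × Y)) :
    ∀ {a b : G.Copy}, G.unfold.Walk a b → Prop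
  | nil {a : G.Copy} : ¬ MatchedBy (G.unfoldEdges M) a →
      EvenPath G M (.nil : G.unfold.Walk a a)
  | cons {a b c d : G.Copy} (h : G.unfold.Adj a b) (h' : G.unfold.Adj b c)
      (p : G.unfold.Walk c d) : s(a, b) ∈ G.unfoldEdges M → s(b, c) ∉ G.unfoldEdges M →
      a ∉ p.support → b ∉ p.support → EvenPath G M p → EvenPath G M (.cons h (.cons h' p))

theorem EvenPath.isAlternating {a b : G.Copy} {p : G.unfold.Walk a b} (hp : EvenPath G M p) :
    IsAlternating (G.unfoldEdges M) p ∧ Even p.length ∧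
      ∀ e ∈ p.edges.head?, e ∈ G.unfoldEdges M := by
  induction hp with
  | nil h => exact ⟨⟨by simp, by simp, fun h' => (h h').elim, fun h' => (h h').elim⟩, by simp,
      by simp⟩
  | @cons a b c d h h' p h1 h2 ha hb hp ih =>
    obtain ⟨⟨i1, i2, i3, i4⟩, i5, i6⟩ := ih
    have hab := h.ne
    refine ⟨⟨?_, ?_, fun _ => ⟨_, by simp, h1⟩, fun hm => ?_⟩, ?_, ?_⟩
    · simp only [SimpleGraph.Walk.cons_isPath_iff, SimpleGraph.Walk.support_cons, List.mem_cons,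
        not_or]
      exact ⟨⟨i1, hb⟩, hab, ha⟩
    · simp only [SimpleGraph.Walk.edges_cons, List.isChain_cons_cons]
      refine ⟨by simp [h1, h2], ?_⟩
      rw [List.isChain_cons]
      exact ⟨fun e he => by simp [h2, i6 e he], i2⟩
    · obtain ⟨e, he, heM⟩ := i4 hm
      refine ⟨e, ?_, heM⟩
      simp only [SimpleGraph.Walk.edges_cons]
      cases hpe : p.edges with
      | nil => simp [hpe] at he
      | cons f t => rw [hpe] at he; simpa [List.getLast?_cons_cons] using he
    · simp only [SimpleGraph.Walk.length_cons]
      rw [add_assoc]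
      exact i5.add (by decide)
    · simp [h1]

/-- Each edge changes sides, so a node on the side of the start is at an even position, and the rest
of the path from there on is again of the required kind. -/
theorem EvenPath.exists_of_mem_support {a b : G.Copy} {p : G.unfold.Walk a b}
    (hp : EvenPath G M p) {c : G.Copy} (hc : c ∈ p.support) (hs : c.1.isLeft = a.1.isLeft) :
    ∃ q : G.unfold.Walk c b, EvenPath G M q := by
  induction hp with
  | nil h =>
    rw [SimpleGraph.Walk.mem_support_nil_iff] at hc
    subst hc
    exact ⟨_, .nil h⟩
  | @cons a b c' d h h' p h1 h2 ha hb hp ih =>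
    have e1 := isLeft_of_adj h
    have e2 := isLeft_of_adj h'
    rw [SimpleGraph.Walk.support_cons, SimpleGraph.Walk.support_cons, List.mem_cons,
      List.mem_cons] at hc
    rcases hc with rfl | rfl | hc
    · exact ⟨_, .cons h h' p h1 h2 ha hb hp⟩
    · exact absurd (hs.symm.trans e1) (by cases a.1.isLeft <;> decide)
    · exact ih hc (by rw [e2, e1, hs, Bool.not_not])

/-- A node on the opposite side is at an odd position, hence entered by a matched edge; its mate is
its predecessor. -/
theorem EvenPath.exists_mate {a b : G.Copy} {p : G.unfold.Walk a b}
    (hp : EvenPath G M p) {c : G.Copy} (hc : c ∈ p.support) (hs : c.1.isLeft ≠ a.1.isLeft) :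
    ∃ d ∈ p.support, s(c, d) ∈ G.unfoldEdges M := by
  induction hp with
  | nil h =>
    rw [SimpleGraph.Walk.mem_support_nil_iff] at hc
    exact (hs (by rw [hc])).elim
  | @cons a b c' d h h' p h1 h2 ha hb hp ih =>
    have e1 := isLeft_of_adj h
    have e2 := isLeft_of_adj h'
    simp only [SimpleGraph.Walk.support_cons, List.mem_cons] at hc ⊢
    rcases hc with rfl | rfl | hc
    · exact (hs rfl).elim
    · exact ⟨a, .inl rfl, by rwa [Sym2.eq_swap]⟩
    · obtain ⟨d, hd, hd'⟩ := ih hc (by rw [e2, e1, Bool.not_not]; exact hs)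
      exact ⟨d, .inr (.inr hd), hd'⟩

/-- For a search step from `a` over `b` to `c`, either `c` is already on the path from `a`, and a
suffix serves, or `c` and `b` are put in front. In the second case `b` is new as well, since a path
through `b` also contains its mate `c`. -/
theorem EvenReachable.exists_evenPath (hM : G.IsMatching M) {a : G.Copy}
    (ha : EvenReachable G M a) : ∃ (b : G.Copy) (p : G.unfold.Walk a b), EvenPath G M p := by
  induction ha with
  | unmatched h => exact ⟨_, .nil, .nil h⟩
  | @step a b c _ hab hbc ih =>
    obtain ⟨z, p, hp⟩ := ih
    have hbc' := (mem_unfoldEdges.1 hbc).1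
    have e1 := isLeft_of_adj hab
    have e2 := isLeft_of_adj hbc'
    rw [e1, Bool.not_not] at e2
    by_cases hc : c ∈ p.support
    · exact ⟨z, hp.exists_of_mem_support hc e2⟩
    · have hb : b ∉ p.support := by
        intro hb
        obtain ⟨d, hd, hbd⟩ := hp.exists_mate hb (by rw [e1]; cases a.1.isLeft <;> decide)
        exact hc (hM.unfoldEdges_unique hbc hbd ▸ hd)
      refine ⟨z, _, .cons hbc'.symm hab.symm p (by rwa [Sym2.eq_swap]) ?_ hc hb hp⟩
      -- If the edge `ab` were matched, then `c` would be `a`, which is on the path.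
      intro h
      exact hc (hM.unfoldEdges_unique hbc h ▸ p.start_mem_support)

/-- Read backwards, the walk is a search from its unmatched last node; each step removes a matched
and an unmatched edge at the front. Repeated nodes do no harm, so walks suffice. -/
theorem evenReachable_of_walk : ∀ (n : ℕ) {a b : G.Copy} (p : G.unfold.Walk a b), p.length = n →
    Even n → p.edges.IsChain (fun e f => e ∈ G.unfoldEdges M ↔ f ∉ G.unfoldEdges M) →
    (∀ e ∈ p.edges.head?, e ∈ G.unfoldEdges M) →
    (MatchedBy (G.unfoldEdges M) b → ∃ e ∈ p.edges.getLast?, e ∈ G.unfoldEdges M) →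
    EvenReachable G M a := by
  intro n
  induction n using Nat.strong_induction_on with
  | _ n ih =>
    rintro a b (_ | ⟨h, _ | ⟨h', p⟩⟩) hn he hch hh hl
    -- A walk of length 0 has no last edge, so the end condition says that its node is unmatched.
    · exact .unmatched fun hm => by simpa using hl hm
    · subst hn
      simp at he
    · rename_i a1 a2
      simp only [SimpleGraph.Walk.edges_cons, List.isChain_cons_cons, List.head?_cons,
        Option.mem_some_iff, forall_eq'] at hch hh hl
      have h2 : s(a1, a2) ∉ G.unfoldEdges M := hch.1.1 hh
      refine .step (b := a1) (ih p.length ?_ p rfl ?_ hch.2.tail ?_ ?_) h'.symm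
        (by rwa [Sym2.eq_swap])
      · simp only [SimpleGraph.Walk.length_cons] at hn
        omega
      · subst hn
        simpa [Nat.even_add_one] using he
      · intro e hm
        have := List.isChain_cons.1 hch.2
        by_contra hne
        exact h2 ((this.1 e hm).2 hne)
      · intro hm
        obtain ⟨e, he, heM⟩ := hl hm
        cases hpe : p.edges with
        | nil =>
          simp only [hpe, List.getLast?_cons_cons, List.getLast?_singleton,
            Option.mem_some_iff] at he
          exact (h2 (he ▸ heM)).elim
        | cons f t =>
          refine ⟨e, ?_, heM⟩
          simpa [hpe, List.getLast?_cons_cons] using he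

/-- The value of `ρ`, in terms of the search. -/
theorem rho_eq_zero_iff (hM : G.IsMatching M) {a : G.Copy} :
    G.rho M a = 0 ↔ EvenReachable G M a := by
  simp only [rho, ite_eq_left_iff, one_ne_zero, imp_false, not_not]
  constructor
  · rintro ⟨b, p, ⟨-, h1, h2, h3⟩, h4⟩
    by_cases hm : MatchedBy (G.unfoldEdges M) a
    · refine evenReachable_of_walk _ p rfl h4 h1 ?_ h3
      obtain ⟨e, he, heM⟩ := h2 hm
      intro f hf
      rwa [Option.mem_unique hf he]
    · exact .unmatched hm
  · intro h
    obtain ⟨b, p, hp⟩ := h.exists_evenPath hM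
    exact ⟨b, p, hp.isAlternating.1, hp.isAlternating.2.1⟩

theorem rho_le_one (a : G.Copy) : G.rho M a ≤ 1 := by
  unfold rho
  split_ifs <;> simp

end Unfolding

end WBGraph

/-! ### The loss caused by deleting a node equals the sum of ρ over its copies. -/

namespace WBGraph

section Cavity

variable {X Y : Type*} {G : WBGraph X Y} {M : Finset (X × Y)} [Fintype X] [Fintype Y]

/-- A cover whose total is at most the weight of the matching `M` is tight on `M` and vanishes off
the ends of `M`. -/
theorem IsCover.tight {c : X ⊕ Y → ℕ} (hc : G.IsCover c) (hM : G.IsMatching M)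
    (hle : ∑ v, c v ≤ G.setWeight M) :
    (∀ u v, Joins M u v → c u + c v = G.nodeWeight u v) ∧ ∀ v, ¬ Covers M v → c v = 0 := by
  classical
  rw [sum_eq_sum_matching hM] at hle
  have h1 : G.setWeight M ≤ ∑ e ∈ M, (c (.inl e.1) + c (.inr e.2)) :=
    Finset.sum_le_sum fun e _ => hc e.1 e.2
  have h2 : ∀ e ∈ M, G.weight e.1 e.2 = c (.inl e.1) + c (.inr e.2) :=
    (Finset.sum_eq_sum_iff_of_le fun e _ => hc e.1 e.2).1
      (show G.setWeight M = _ by omega)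
  have h3 : ∑ v with ¬ Covers M v, c v = 0 := by omega
  rw [Finset.sum_eq_zero_iff] at h3
  refine ⟨fun u v h => ?_, fun v hv => h3 v (by simpa using hv)⟩
  rcases u with u | u <;> rcases v with v | v <;> simp only [Joins] at h
  · exact (h2 _ h).symm
  · rw [add_comm]
    exact (h2 _ h).symm

section MinCover

variable {c : X ⊕ Y → ℕ} (hc : G.IsCover c) (hM : G.IsMatching M)
  (hle : ∑ v, c v ≤ G.setWeight M)

include hc hM hle

/-- An unmatched copy of a covered node is numbered at least the weight of the matched edge, which
by tightness is at least the cover value. At an uncovered node the value is 0. -/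
theorem le_of_not_matchedBy {a : G.Copy} (ha : ¬ MatchedBy (G.unfoldEdges M) a) :
    c a.1 ≤ a.2 := by
  obtain ⟨u, i⟩ := a
  obtain ⟨ht, h0⟩ := hc.tight hM hle
  by_cases hu : Covers M u
  · obtain ⟨v, hv⟩ := hu.exists_joins
    have h1 := ht _ _ hv
    have h2 : ¬ (i : ℕ) < G.nodeWeight u v := fun h => ha (matchedBy_of_joins hv h)
    dsimp only
    omega
  · exact (h0 u hu).trans_le (Nat.zero_le _)

/-- If `a` has number at least `c a`, the cover inequality forces its neighbour `b` below `c b`, and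
tightness on the matched edge then forces the mate of `b` back to at least its cover value. -/
theorem EvenReachable.le {a : G.Copy} (ha : EvenReachable G M a) : c a.1 ≤ a.2 := by
  obtain ⟨ht, -⟩ := hc.tight hM hle
  induction ha with
  | unmatched h => exact le_of_not_matchedBy hc hM hle h
  | @step a b d _ hab hbd ih =>
    rw [mem_unfoldEdges] at hbd
    have h1 : (a.2 : ℕ) + b.2 + 1 = G.nodeWeight a.1 b.1 := hab
    have h2 : (b.2 : ℕ) + d.2 + 1 = G.nodeWeight b.1 d.1 := hbd.1
    have h3 := hc.nodeWeight_le a.1 b.1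
    have h4 := ht _ _ hbd.2
    omega

/-- There is no augmenting path: if both ends had numbers at least their cover values, the numbers
plus one would exceed the weight of the edge. -/
theorem EvenReachable.matchedBy_of_adj {a b : G.Copy} (ha : EvenReachable G M a)
    (hab : G.unfold.Adj a b) : MatchedBy (G.unfoldEdges M) b := by
  by_contra hb
  have h1 : (a.2 : ℕ) + b.2 + 1 = G.nodeWeight a.1 b.1 := hab
  have h2 := hc.nodeWeight_le a.1 b.1
  have h3 := ha.le hc hM hle
  have h4 := le_of_not_matchedBy hc hM hle hb
  omega

/-- The copies of `u` numbered below `c u` all exist and are all unreachable. -/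
theorem le_sum_rho (u : X ⊕ Y) : c u ≤ ∑ i, G.rho M ⟨u, i⟩ := by
  have hcu : c u ≤ G.heaviest u := by
    obtain ⟨ht, h0⟩ := hc.tight hM hle
    by_cases hu : Covers M u
    · obtain ⟨v, hv⟩ := hu.exists_joins
      have h1 := ht _ _ hv
      have h2 := G.nodeWeight_le_heaviest u v
      omega
    · exact (h0 u hu).trans_le (Nat.zero_le _)
  calc c u = ∑ i : Fin (c u), 1 := by simp
    _ ≤ ∑ i : Fin (c u), G.rho M ⟨u, Fin.castLE hcu i⟩ := Finset.sum_le_sum fun i _ => by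
        rw [Nat.one_le_iff_ne_zero, Ne, rho_eq_zero_iff hM]
        intro h
        have := h.le hc hM hle
        simp only [Fin.val_castLE] at this
        omega
    _ = ∑ i ∈ Finset.univ.map (Fin.castLEEmb hcu), G.rho M ⟨u, i⟩ := by simp
    _ ≤ ∑ i, G.rho M ⟨u, i⟩ := Finset.sum_le_sum_of_subset (Finset.subset_univ _)

end MinCover

open Classical in
/-- The number of copies of `v` in a set of copies. -/
noncomputable def copyCount (S : Set G.Copy) (v : X ⊕ Y) : ℕ :=
  ((Finset.range (G.heaviest v)).filter fun i => ∃ h, (⟨v, ⟨i, h⟩⟩ : G.Copy) ∈ S).card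

-- The reflection i ↦ n - 1 - i sends a copy to the number of its partner along an edge of weight n.
-- It lets the copies of both ends be counted by the same index.
open Classical in
theorem copyCount_eq {S : Set G.Copy} {v : X ⊕ Y} {n : ℕ} (hn : n ≤ G.heaviest v)
    (hS : ∀ a ∈ S, a.1 = v → (a.2 : ℕ) < n) :
    copyCount S v =
      ((Finset.range n).filter fun i => ∃ h, (⟨v, ⟨n - 1 - i, h⟩⟩ : G.Copy) ∈ S).card := by
  refine Finset.card_bij' (fun i _ => n - 1 - i) (fun i _ => n - 1 - i) ?_ ?_ ?_ ?_
  · intro i hi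
    simp only [Finset.mem_filter, Finset.mem_range] at hi ⊢
    obtain ⟨h, hi⟩ := hi.2
    have h1 := hS _ hi rfl
    dsimp only at h1
    have h2 : n - 1 - (n - 1 - i) = i := by omega
    exact ⟨by omega, by simpa only [h2] using ⟨h, hi⟩⟩
  · intro i hi
    simp only [Finset.mem_filter, Finset.mem_range] at hi ⊢
    exact ⟨by omega, hi.2⟩
  · intro i hi
    simp only [Finset.mem_filter, Finset.mem_range] at hi
    obtain ⟨h, hi⟩ := hi.2
    have h1 := hS _ hi rfl
    dsimp only at h1
    omega
  · intro i hi
    simp only [Finset.mem_filter, Finset.mem_range] at hi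
    omega

open Classical in
theorem copyCount_eq_zero {S : Set G.Copy} {v : X ⊕ Y} (h : ∀ a ∈ S, a.1 ≠ v) :
    copyCount S v = 0 :=
  Finset.card_eq_zero.2 (Finset.filter_eq_empty_iff.2 fun _ _ ⟨_, hi⟩ => h _ hi rfl)

theorem copyCount_mono {S T : Set G.Copy} (h : S ⊆ T) (v : X ⊕ Y) :
    copyCount S v ≤ copyCount T v :=
  Finset.card_le_card fun i hi => by
    simp only [Finset.mem_filter] at hi ⊢
    exact ⟨hi.1, hi.2.imp fun _ h' => h h'⟩

/-- The numbers of copies in a node cover of the unfolded graph form a weighted cover. -/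
theorem nodeWeight_le_copyCount {S : Set G.Copy}
    (hS : ∀ a b, G.unfold.Adj a b → a ∈ S ∨ b ∈ S) (u v : X ⊕ Y) :
    G.nodeWeight u v ≤ copyCount S u + copyCount S v := by
  classical
  set n := G.nodeWeight u v with hn
  have hu : n ≤ G.heaviest u := G.nodeWeight_le_heaviest u v
  have hv : n ≤ G.heaviest v := by
    rw [hn, nodeWeight_comm]
    exact G.nodeWeight_le_heaviest v u
  -- Only the copies below n are ends of the unfolded edges of uv, so the others are discarded
  -- before reflecting.
  have h1 : copyCount {a ∈ S | (a.2 : ℕ) < n} v ≤ copyCount S v :=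
    copyCount_mono (fun a ha => ha.1) v
  rw [copyCount_eq hv (fun a ha _ => ha.2)] at h1
  refine le_trans ?_ (Nat.add_le_add_left h1 _)
  rw [copyCount]
  refine le_trans ?_ (Finset.card_union_le _ _)
  conv_lhs => rw [← Finset.card_range n]
  refine Finset.card_le_card fun i hi => ?_
  rw [Finset.mem_range] at hi
  simp only [Finset.mem_union, Finset.mem_filter, Finset.mem_range]
  have hadj : G.unfold.Adj ⟨u, ⟨i, by omega⟩⟩ ⟨v, ⟨n - 1 - i, by omega⟩⟩ := by
    change i + (n - 1 - i) + 1 = n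
    omega
  rcases hS _ _ hadj with h | h
  · exact .inl ⟨by omega, _, h⟩
  · refine .inr ⟨hi, by omega, h, ?_⟩
    change n - 1 - i < n
    omega

/-- If `S` has no two copies of the ends of a matched edge that are matched, and only matched
copies, then it has at most as many copies of the ends as the weight of the edge. -/
theorem copyCount_le_nodeWeight (hM : G.IsMatching M) {S : Set G.Copy}
    (hS : ∀ a b, s(a, b) ∈ G.unfoldEdges M → ¬ (a ∈ S ∧ b ∈ S))
    (hS' : ∀ a ∈ S, MatchedBy (G.unfoldEdges M) a) {u v : X ⊕ Y} (huv : Joins M u v) :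
    copyCount S u + copyCount S v ≤ G.nodeWeight u v := by
  classical
  set n := G.nodeWeight u v with hn
  have hu : n ≤ G.heaviest u := G.nodeWeight_le_heaviest u v
  have hv : n ≤ G.heaviest v := by
    rw [hn, nodeWeight_comm]
    exact G.nodeWeight_le_heaviest v u
  -- A matched copy is numbered below the weight of the matched edge at its node.
  have hlt : ∀ {u v}, Joins M u v → ∀ a ∈ S, a.1 = u → (a.2 : ℕ) < G.nodeWeight u v := by
    rintro u v huv ⟨u, i⟩ ha rfl
    obtain ⟨b, hb⟩ := matchedBy_unfoldEdges.1 (hS' _ ha)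
    rw [mem_unfoldEdges] at hb
    have h1 := hM.joins_unique huv hb.2
    have h2 : (i : ℕ) + b.2 + 1 = G.nodeWeight u b.1 := hb.1
    rw [h1]
    dsimp only
    omega
  have hlu := hlt huv
  have hlv := hlt huv.symm
  rw [nodeWeight_comm] at hlv
  -- After reflection both ends are counted by indices of the n unfolded edges, and no edge is
  -- counted twice because `S` contains at most one of its ends.
  rw [copyCount_eq hv hlv, copyCount, ← Finset.card_union_of_disjoint]
  · conv_rhs => rw [← Finset.card_range n]
    refine Finset.card_le_card fun i hi => ?_
    simp only [Finset.mem_union, Finset.mem_filter, Finset.mem_range] at hi ⊢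
    rcases hi with ⟨_, _, h⟩ | h
    · exact hlu _ h rfl
    · exact h.1
  · rw [Finset.disjoint_left]
    intro i hi hi'
    simp only [Finset.mem_filter, Finset.mem_range] at hi hi'
    obtain ⟨-, h1, h2⟩ := hi
    obtain ⟨h3, h4, h5⟩ := hi'
    refine hS _ _ (mem_unfoldEdges.2 ⟨?_, huv⟩) ⟨h2, h5⟩
    change i + (n - 1 - i) + 1 = n
    omega

theorem sum_rho_eq_copyCount (hM : G.IsMatching M) {S : Set G.Copy} (u : X ⊕ Y)
    (hS : ∀ a : G.Copy, a.1 = u → (a ∈ S ↔ ¬ EvenReachable G M a)) :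
    ∑ i, G.rho M ⟨u, i⟩ = copyCount S u := by
  classical
  have h : ∀ i, G.rho M ⟨u, i⟩ = if (⟨u, i⟩ : G.Copy) ∈ S then 1 else 0 := by
    intro i
    have h1 := rho_le_one (M := M) (⟨u, i⟩ : G.Copy)
    have h2 := rho_eq_zero_iff hM (a := ⟨u, i⟩)
    have h3 := hS ⟨u, i⟩ rfl
    split_ifs with h4
    · have := mt h2.1 (h3.1 h4)
      omega
    · exact h2.2 (not_not.1 (mt h3.2 h4))
  rw [Finset.sum_congr rfl fun i _ => h i, Finset.sum_boole, copyCount]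
  simp only [Nat.cast_id]
  refine Finset.card_bij (fun i _ => (i : ℕ)) ?_ (fun _ _ _ _ h => Fin.ext h) ?_
  · intro i hi
    simp only [Finset.mem_filter, Finset.mem_range] at hi ⊢
    exact ⟨i.2, i.2, hi.2⟩
  · intro i hi
    simp only [Finset.mem_filter, Finset.mem_range] at hi
    obtain ⟨-, h1, h2⟩ := hi
    exact ⟨⟨i, h1⟩, by simpa using h2, rfl⟩

variable [DecidableEq X] [DecidableEq Y]

/-- The loss of weight that the deletion of a node causes. -/
theorem mwm_deleteNode_add_sum_rho (hM : G.IsMaxWeightMatching M) (u : X ⊕ Y) :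
    (G.deleteNode u).mwm + ∑ i, G.rho M ⟨u, i⟩ = G.setWeight M := by
  classical
  obtain ⟨hM, hmax⟩ := hM
  obtain ⟨c, hc, hle, hcu⟩ := G.exists_cover_sum_le_mwm u
  rw [← hmax] at hle hcu
  -- The direction "loss ≤ sum of ρ" is immediate from the cover `c`; the other one needs the König
  -- cover `S`.
  refine le_antisymm ?_ (hcu.trans (Nat.add_le_add_left (le_sum_rho hc hM hle u) _))
  let S : Set G.Copy := {a | if a.1.isLeft = u.isLeft then ¬ EvenReachable G M a else
    ∃ b, EvenReachable G M b ∧ G.unfold.Adj b a}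
  have hS1 : ∀ a : G.Copy, a.1.isLeft = u.isLeft → (a ∈ S ↔ ¬ EvenReachable G M a) :=
    fun a ha => by simp [S, ha]
  have hS2 : ∀ a : G.Copy, a.1.isLeft ≠ u.isLeft →
      (a ∈ S ↔ ∃ b, EvenReachable G M b ∧ G.unfold.Adj b a) := fun a ha => by simp [S, ha]
  have hside : ∀ {a b : G.Copy}, G.unfold.Adj a b →
      (a.1.isLeft = u.isLeft ∧ b.1.isLeft ≠ u.isLeft) ∨
        (b.1.isLeft = u.isLeft ∧ a.1.isLeft ≠ u.isLeft) := by
    intro a b h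
    rw [isLeft_of_adj h]
    cases a.1.isLeft <;> cases u.isLeft <;> decide
  have hS3 : ∀ a b, G.unfold.Adj a b → a.1.isLeft = u.isLeft → b.1.isLeft ≠ u.isLeft →
      a ∈ S ∨ b ∈ S := by
    intro a b h ha hb
    rw [hS1 a ha, hS2 b hb]
    by_cases hr : EvenReachable G M a
    · exact .inr ⟨a, hr, h⟩
    · exact .inl hr
  have hS4 : ∀ a b, s(b, a) ∈ G.unfoldEdges M → a.1.isLeft = u.isLeft →
      b.1.isLeft ≠ u.isLeft → ¬ (a ∈ S ∧ b ∈ S) := by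
    rintro a b h ha hb ⟨h1, h2⟩
    obtain ⟨b', h3, h4⟩ := (hS2 b hb).1 h2
    exact (hS1 a ha).1 h1 (.step h3 h4 h)
  have hd := sum_rho_eq_copyCount hM (S := S) u fun a ha => hS1 a (by rw [ha])
  have hcov : G.IsCover (copyCount S) := fun x y =>
    nodeWeight_le_copyCount (fun a b h => (hside h).elim (fun h' => hS3 a b h h'.1 h'.2)
      fun h' => (hS3 b a h.symm h'.1 h'.2).symm) (.inl x) (.inr y)
  -- Unreachable copies are matched because unmatched ones are starting points of the search;
  -- neighbours of reachable copies are matched because `c` excludes augmenting paths.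
  have hS' : ∀ a ∈ S, MatchedBy (G.unfoldEdges M) a := by
    intro a ha
    by_cases hau : a.1.isLeft = u.isLeft
    · by_contra hm
      exact (hS1 a hau).1 ha (.unmatched hm)
    · obtain ⟨b, hb, hab⟩ := (hS2 a hau).1 ha
      exact hb.matchedBy_of_adj hc hM hle hab
  have hnd : ∀ a b, s(a, b) ∈ G.unfoldEdges M → ¬ (a ∈ S ∧ b ∈ S) := by
    intro a b h
    rcases hside (mem_unfoldEdges.1 h).1 with h' | h'
    · exact hS4 a b (by rwa [Sym2.eq_swap]) h'.1 h'.2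
    · exact fun h'' => hS4 b a h h'.1 h'.2 h''.symm
  -- Every copy in `S` lies at an end of `M`, and the two ends of an edge of `M` share at most its
  -- weight.
  have htot : ∑ v, copyCount S v ≤ G.setWeight M := by
    rw [sum_eq_sum_matching hM, Finset.sum_eq_zero (s := Finset.univ.filter _), add_zero]
    · exact Finset.sum_le_sum fun e he =>
        copyCount_le_nodeWeight hM hnd hS' (u := .inl e.1) (v := .inr e.2) he
    · intro v hv
      rw [Finset.mem_filter] at hv
      refine copyCount_eq_zero fun a ha hav => hv.2 ?_
      obtain ⟨b, hb⟩ := matchedBy_unfoldEdges.1 (hS' _ ha)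
      exact hav ▸ (mem_unfoldEdges.1 hb).2.covers
  obtain ⟨M', hM', hu, hw⟩ := G.exists_matching_of_deleteNode u
  rw [hd, ← hw]
  -- The cover pays for each edge of `M'` at its ends, and its value at the uncovered node `u` is
  -- left over.
  refine le_trans ?_ htot
  rw [sum_eq_sum_matching hM']
  exact Nat.add_le_add (Finset.sum_le_sum fun e _ => hcov e.1 e.2)
    (Finset.single_le_sum (f := copyCount S) (fun _ _ => Nat.zero_le _) (by simpa using hu))

end Cavity

end WBGraph

/-! ### Reasoning about programs: time-bounded postconditions, frames and loops. -/

namespace RAM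

section Logic

variable {R A : Type}

@[simp] theorem Expr.eval_add (s : State R A) (e f : Expr R A) :
    (e + f).eval s = e.eval s + f.eval s := rfl

@[simp] theorem Expr.eval_sub (s : State R A) (e f : Expr R A) :
    (e - f).eval s = e.eval s - f.eval s := rfl

@[simp] theorem Expr.eval_zero (s : State R A) : (0 : Expr R A).eval s = 0 := rfl

@[simp] theorem Expr.eval_one (s : State R A) : (1 : Expr R A).eval s = 1 := rfl

@[simp] theorem Expr.eval_reg (s : State R A) (x : R) : (Expr.reg x).eval s = s.reg x := rfl

@[simp] theorem Expr.eval_get (s : State R A) (a : A) (i : Expr R A) :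
    (Expr.get a i).eval s = s.arr a (i.eval s) := rfl

@[simp] theorem Expr.eval_lt (s : State R A) (e f : Expr R A) :
    (Expr.lt e f).eval s = if e.eval s < f.eval s then 1 else 0 := rfl

variable [DecidableEq R] [DecidableEq A]

@[simp] theorem State.setReg_reg (s : State R A) (x y : R) (k : ℕ) :
    (s.setReg x k).reg y = if y = x then k else s.reg y := by
  simp [State.setReg, Function.update_apply]

@[simp] theorem State.setReg_arr (s : State R A) (x : R) (k : ℕ) :
    (s.setReg x k).arr = s.arr := rfl

@[simp] theorem State.setArr_reg (s : State R A) (a : A) (i k : ℕ) :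
    (s.setArr a i k).reg = s.reg := rfl

theorem State.setArr_arr (s : State R A) (a b : A) (i k : ℕ) :
    (s.setArr a i k).arr b = if b = a then Function.update (s.arr a) i k else s.arr b := by
  rcases eq_or_ne b a with rfl | h
  · simp [State.setArr]
  · simp [State.setArr, h]

@[simp] theorem State.setArr_arr_self (s : State R A) (a : A) (i k : ℕ) :
    (s.setArr a i k).arr a = Function.update (s.arr a) i k := by
  simp [State.setArr_arr]

theorem State.setArr_arr_of_ne (s : State R A) {a b : A} (h : b ≠ a) (i k : ℕ) :
    (s.setArr a i k).arr b = s.arr b := by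
  simp [State.setArr_arr, h]

/-- The command `c` halts on `s` within `T` steps, in a state that satisfies `Q`. -/
def Halts (c : Cmd R A) (s : State R A) (T : ℕ) (Q : State R A → Prop) : Prop :=
  ∃ s' t, Exec c s s' t ∧ t ≤ T ∧ Q s'

theorem Halts.mono {c : Cmd R A} {s : State R A} {T T' : ℕ} {Q Q' : State R A → Prop}
    (h : Halts c s T Q) (hT : T ≤ T') (hQ : ∀ s', Q s' → Q' s') : Halts c s T' Q' := by
  obtain ⟨s', t, h1, h2, h3⟩ := h
  exact ⟨s', t, h1, h2.trans hT, hQ _ h3⟩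

theorem Halts.seq {c d : Cmd R A} {s : State R A} {T₁ T₂ : ℕ} {P Q : State R A → Prop}
    (h : Halts c s T₁ P) (h' : ∀ s', P s' → Halts d s' T₂ Q) :
    Halts (.seq c d) s (T₁ + T₂) Q := by
  obtain ⟨s₁, t₁, h1, h2, h3⟩ := h
  obtain ⟨s₂, t₂, h4, h5, h6⟩ := h' s₁ h3
  exact ⟨s₂, _, .seq h1 h4, by omega, h6⟩

/-- The command contains no loop. -/
def Cmd.loopFree : Cmd R A → Bool
  | .seq c d => c.loopFree && d.loopFree
  | .ite _ c d => c.loopFree && d.loopFree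
  | .while _ _ => false
  | _ => true

/-- The effect of a loop-free command. -/
def Cmd.run : Cmd R A → State R A → State R A
  | .assign x e, s => s.setReg x (e.eval s)
  | .store a i e, s => s.setArr a (i.eval s) (e.eval s)
  | .seq c d, s => d.run (c.run s)
  | .ite e c d, s => if e.eval s = 0 then d.run s else c.run s
  | _, s => s

/-- An upper bound for the number of steps of a loop-free command. -/
def Cmd.bound : Cmd R A → ℕ
  | .assign _ e => e.cost + 1
  | .store _ i e => i.cost + e.cost + 1
  | .seq c d => c.bound + d.bound
  | .ite e c d => e.cost + 1 + (c.bound + d.bound)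
  | _ => 1

/-- Turns a loop body into a state transformer with a constant time bound; `Cmd.bound` charges both
branches of a test, so it does not depend on the state. -/
theorem Halts.of_loopFree {c : Cmd R A} (hc : c.loopFree = true) (s : State R A)
    {Q : State R A → Prop} (hQ : Q (c.run s)) : Halts c s c.bound Q := by
  suffices h : ∃ t, Exec c s (c.run s) t ∧ t ≤ c.bound from
    let ⟨t, h1, h2⟩ := h
    ⟨_, t, h1, h2, hQ⟩
  clear hQ
  induction c generalizing s with
  | assign x e => exact ⟨_, .assign x e s, le_rfl⟩
  | store a i e => exact ⟨_, .store a i e s, le_rfl⟩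
  | seq c d ihc ihd =>
    simp only [Cmd.loopFree, Bool.and_eq_true] at hc
    obtain ⟨t, h1, h2⟩ := ihc hc.1 s
    obtain ⟨t', h3, h4⟩ := ihd hc.2 (c.run s)
    exact ⟨_, .seq h1 h3, Nat.add_le_add h2 h4⟩
  | ite e c d ihc ihd =>
    simp only [Cmd.loopFree, Bool.and_eq_true] at hc
    simp only [Cmd.run, Cmd.bound]
    split_ifs with he
    · obtain ⟨t, h1, h2⟩ := ihd hc.2 s
      exact ⟨_, .ite_false he h1, by omega⟩
    · obtain ⟨t, h1, h2⟩ := ihc hc.1 s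
      exact ⟨_, .ite_true he h1, by omega⟩
  | skip => exact ⟨_, .skip s, le_rfl⟩
  | _ => simp [Cmd.loopFree] at hc

/-- The registers that a command may write. -/
def Cmd.writesReg : Cmd R A → R → Bool
  | .assign x _, y => decide (y = x)
  | .seq c d, y => c.writesReg y || d.writesReg y
  | .ite _ c d, y => c.writesReg y || d.writesReg y
  | .while _ c, y => c.writesReg y
  | _, _ => false

/-- The arrays that a command may write. -/
def Cmd.writesArr : Cmd R A → A → Bool
  | .store a _ _, b => decide (b = a)
  | .seq c d, b => c.writesArr b || d.writesArr b
  | .ite _ c d, b => c.writesArr b || d.writesArr b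
  | .while _ c, b => c.writesArr b
  | _, _ => false

/-- The states `s` and `s'` agree on everything that `c` does not write. -/
def Frame (c : Cmd R A) (s s' : State R A) : Prop :=
  (∀ x, c.writesReg x = false → s'.reg x = s.reg x) ∧
    ∀ a, c.writesArr a = false → s'.arr a = s.arr a

theorem Frame.refl (c : Cmd R A) (s : State R A) : Frame c s s :=
  ⟨fun _ _ => rfl, fun _ _ => rfl⟩

theorem Frame.trans {c : Cmd R A} {s s' s'' : State R A} (h : Frame c s s')
    (h' : Frame c s' s'') : Frame c s s'' :=
  ⟨fun x hx => (h'.1 x hx).trans (h.1 x hx), fun x hx => (h'.2 x hx).trans (h.2 x hx)⟩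

theorem Frame.of_imp {c d : Cmd R A} {s s' : State R A} (h : Frame c s s')
    (h1 : ∀ x, d.writesReg x = false → c.writesReg x = false)
    (h2 : ∀ x, d.writesArr x = false → c.writesArr x = false) : Frame d s s' :=
  ⟨fun x hx => h.1 x (h1 x hx), fun x hx => h.2 x (h2 x hx)⟩

/-- Lets invariants mention only what a loop changes. The written registers and arrays are computed,
so the side conditions hold by `rfl`. -/
theorem Exec.frame {c : Cmd R A} {s s' : State R A} {t : ℕ} (h : Exec c s s' t) :
    Frame c s s' := by
  induction h with
  | assign x e s => exact ⟨fun y hy => by simp_all [Cmd.writesReg], fun _ _ => rfl⟩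
  | store a i e s =>
    exact ⟨fun _ _ => rfl, fun b hb => by
      rw [State.setArr_arr_of_ne]
      simpa [Cmd.writesArr] using hb⟩
  | seq _ _ ih ih' =>
    exact (ih.of_imp (by simp_all [Cmd.writesReg]) (by simp_all [Cmd.writesArr])).trans
      (ih'.of_imp (by simp_all [Cmd.writesReg]) (by simp_all [Cmd.writesArr]))
  | ite_true _ _ ih =>
    exact ih.of_imp (by simp_all [Cmd.writesReg]) (by simp_all [Cmd.writesArr])
  | ite_false _ _ ih =>
    exact ih.of_imp (by simp_all [Cmd.writesReg]) (by simp_all [Cmd.writesArr])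
  | skip => exact .refl _ _
  | while_true _ _ _ ih ih' => exact (show Frame _ _ _ from ih).trans ih'
  | while_false => exact .refl _ _

theorem Halts.frame {c : Cmd R A} {s : State R A} {T : ℕ} {Q : State R A → Prop}
    (h : Halts c s T Q) : Halts c s T fun s' => Frame c s s' ∧ Q s' := by
  obtain ⟨s', t, h1, h2, h3⟩ := h
  exact ⟨s', t, h1, h2, h1.frame, h3⟩

theorem Cmd.run_frame {c : Cmd R A} (hc : c.loopFree = true) (s : State R A) :
    Frame c s (c.run s) := by
  obtain ⟨s', t, h, -, rfl⟩ := Halts.of_loopFree hc s (Q := fun s' => s' = c.run s) rfl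
  exact h.frame

/-- A loop with an invariant and a potential that decreases in each round. -/
theorem Halts.whileLoop {e : Expr R A} {c : Cmd R A} (I : ℕ → State R A → Prop) (K : ℕ)
    (h : ∀ n s, I n s → e.eval s ≠ 0 → Halts c s K fun s' => ∃ k < n, I k s') :
    ∀ n s, I n s → Halts (.while e c) s ((e.cost + 1 + K) * n + (e.cost + 1))
      fun s' => e.eval s' = 0 ∧ ∃ k, I k s' := by
  intro n
  induction n using Nat.strong_induction_on with
  | _ n ih =>
    intro s hs
    by_cases he : e.eval s = 0
    · exact ⟨s, _, .while_false he, by omega, he, n, hs⟩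
    · obtain ⟨s₁, t₁, h1, h2, k, hk, h3⟩ := h n s hs he
      obtain ⟨s₂, t₂, h4, h5, h6⟩ := ih k hk s₁ h3
      refine ⟨s₂, _, .while_true he h1 h4, ?_, h6⟩
      have := Nat.mul_le_mul_left (e.cost + 1 + K) hk
      rw [Nat.mul_succ] at this
      omega

end Logic

end RAM

namespace AllCavity

open RAM

@[simp] theorem eval_r (s : State Reg Arr) (x : Reg) : (r x).eval s = s.reg x := rfl

/-- A counting loop with an invariant and a time bound for each round. -/
theorem halts_forLoop {i : Reg} {bound : Expr Reg Arr} {body : Cmd Reg Arr} {s : State Reg Arr}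
    {n : ℕ} (I : ℕ → State Reg Arr → Prop) (f : ℕ → ℕ)
    (h0 : I 0 (s.setReg i 0))
    (hbound : ∀ j s', Frame (forLoop i bound body) s s' → I j s' → bound.eval s' = n)
    (hbody : ∀ j < n, ∀ s', Frame (forLoop i bound body) s s' → I j s' → s'.reg i = j →
      Halts body s' (f j) fun s'' => s''.reg i = j ∧ I (j + 1) (s''.setReg i (j + 1))) :
    Halts (forLoop i bound body) s
      (∑ j ∈ Finset.range n, (f j + (bound.cost + 7)) + (bound.cost + 5))
      fun s' => Frame (forLoop i bound body) s s' ∧ I n s' := by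
  have hi : (forLoop i bound body).writesReg i = true := by
    simp [forLoop, Cmd.writesReg]
  have hset : ∀ s' k, Frame (forLoop i bound body) s s' →
      Frame (forLoop i bound body) s (s'.setReg i k) := by
    intro s' k h
    refine ⟨fun x hx => ?_, fun a ha => h.2 a ha⟩
    have : x ≠ i := by
      rintro rfl
      simp [hi] at hx
    rw [State.setReg_reg, if_neg this]
    exact h.1 x hx
  -- Here `k` is the number of rounds left. A round takes `bound.cost + 3` steps for the test and 4
  -- for the increment besides its body; the failing test takes `bound.cost + 3` and the initial
  -- assignment 2.
  have key : ∀ k j s', k + j = n → Frame (forLoop i bound body) s s' → I j s' → s'.reg i = j →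
      Halts (.while (r i ≺ bound) (body ;; i ≔ r i + 1)) s'
        (∑ j ∈ Finset.Ico j n, (f j + (bound.cost + 7)) + (bound.cost + 3))
        fun s' => Frame (forLoop i bound body) s s' ∧ I n s' := by
    intro k
    induction k with
    | zero =>
      intro j s' hj hf hI hij
      rw [zero_add] at hj
      subst hj
      refine ⟨s', _, .while_false ?_, ?_, hf, hI⟩
      · simp [hij, hbound _ _ hf hI]
      · simp only [Expr.cost]
        omega
    | succ k ih =>
      intro j s' hj hf hI hij
      obtain ⟨s₁, t₁, h1, h2, h3, h4⟩ := hbody j (by omega) s' hf hI hij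
      have hf1 : Frame (forLoop i bound body) s s₁ := hf.trans (h1.frame.of_imp
        (by simp +contextual [forLoop, Cmd.writesReg])
        (by simp +contextual [forLoop, Cmd.writesArr]))
      obtain ⟨s₂, t₂, h5, h6, h7⟩ := ih (j + 1) (s₁.setReg i (j + 1)) (by omega)
        (hset _ _ hf1) h4 (by simp)
      refine ⟨s₂, _, .while_true ?_ (.seq h1 (.assign i (r i + 1) s₁)) (by simpa [h3] using h5),
        ?_, h7⟩
      · have := hbound _ _ hf hI
        simp only [Expr.eval_lt, eval_r, hij, this]
        rw [if_pos (by omega)]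
        exact one_ne_zero
      · rw [Finset.sum_eq_sum_Ico_succ_bot (by omega : j < n)]
        have hc : (r i + 1 : Expr Reg Arr).cost = 3 := rfl
        simp only [Expr.cost] at hc ⊢
        omega
  obtain ⟨s₁, t₁, h1, h2, h3⟩ := key n 0 (s.setReg i 0) (by omega) (hset _ _ (.refl _ _)) h0
    (by simp)
  refine ⟨s₁, _, .seq (.assign i 0 s) h1, ?_, h3⟩
  rw [Finset.range_eq_Ico]
  have hc : (0 : Expr Reg Arr).cost = 1 := rfl
  omega

end AllCavity

/-! ### Construction of the unfolded graph: heights, numbering, arcs and mates. -/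

namespace AllCavity

open RAM

/-- The common form of the two tests in `findHeights`: one entry is replaced by a maximum. Thus the
heights are a supremum over the edges read so far. -/
theorem raise_run (s : State Reg Arr) (u k : Expr Reg Arr) :
    let s' := (Cmd.ite (.get .height u ≺ k) (.store .height u k) .skip).run s
    (∀ v, s'.arr .height v = max (if v = u.eval s then k.eval s else 0) (s.arr .height v)) ∧
      s'.reg = s.reg ∧ ∀ a ≠ Arr.height, s'.arr a = s.arr a := by
  simp only [Cmd.run, Expr.eval_lt, Expr.eval_get]
  by_cases h : s.arr .height (u.eval s) < k.eval s
  · simp only [h, if_true, one_ne_zero, if_false, State.setArr_arr_self, State.setArr_reg,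
      Function.update_apply, true_and]
    refine ⟨fun v => ?_, fun a ha => State.setArr_arr_of_ne _ ha _ _⟩
    split_ifs with hv
    · rw [hv, max_eq_left h.le]
    · simp
  · simp only [h, if_false, if_true, implies_true, and_true]
    intro v
    split_ifs with hv
    · rw [hv, max_eq_right (not_lt.1 h)]
    · simp

theorem findHeights_halts (s : State Reg Arr) (hs : ∀ v, s.arr .height v = 0) :
    Halts findHeights s (1000 * (s.reg .m + 1)) fun s' => Frame findHeights s s' ∧
      ∀ v, s'.arr .height v = (Finset.range (s.reg .m)).sup fun j =>
        if s.arr .ex j = v ∨ s.reg .nx + s.arr .ey j = v then s.arr .ew j else 0 := by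
  refine Halts.mono (halts_forLoop (n := s.reg .m)
    (fun k s' => ∀ v, s'.arr .height v = (Finset.range k).sup fun j =>
        if s.arr .ex j = v ∨ s.reg .nx + s.arr .ey j = v then s.arr .ew j else 0)
    (fun _ => 100) ?_ ?_ ?_) ?_ fun s' h => h
  · simpa using hs
  · intro j s' hf _
    exact hf.1 .m rfl
  · intro j hj s' hf hI hj'
    refine (Halts.of_loopFree rfl s' (Q := fun s'' => s''.reg .e = j ∧ _) ?_).mono (by decide)
      fun s' h => h
    have h1 := hf.2 .ex rfl
    have h2 := hf.2 .ey rfl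
    have h3 := hf.2 .ew rfl
    have h4 := hf.1 .nx rfl
    simp only [Finset.range_add_one, Finset.sup_insert, ← hI]
    rw [Cmd.run]
    obtain ⟨a1, a2, a3⟩ := raise_run s' (.get .ex (r .e)) (.get .ew (r .e))
    set s₁ := (Cmd.ite (.get .height (.get .ex (r .e)) ≺ .get .ew (r .e))
      (.store .height (.get .ex (r .e)) (.get .ew (r .e))) .skip).run s'
    obtain ⟨b1, b2, -⟩ := raise_run s₁ (r .nx + .get .ey (r .e)) (.get .ew (r .e))
    refine ⟨by rw [b2, a2, hj'], fun v => ?_⟩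
    rw [State.setReg_arr, b1, a1]
    simp only [Expr.eval_get, Expr.eval_add, eval_r, a2, a3 .ey (by decide), a3 .ew (by decide),
      hj', h1, h2, h3, h4, eq_comm (a := v), ← max_assoc]
    congr 1
    by_cases hx : s.arr .ex j = v <;> by_cases hy : s.reg .nx + s.arr .ey j = v <;> simp [hx, hy]
  · simp only [Finset.sum_const, Finset.card_range, smul_eq_mul, Expr.cost]
    omega

/-- The case v = nx + ny matters: there `off` is the number of all copies, which bounds the first
loop of the search. -/
theorem numberCopies_halts (s : State Reg Arr) (hs : s.arr .off 0 = 0) :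
    Halts numberCopies s (1000 * (s.reg .nx + s.reg .ny + 1)) fun s' => Frame numberCopies s s' ∧
      ∀ v ≤ s.reg .nx + s.reg .ny, s'.arr .off v = ∑ u ∈ Finset.range v, s.arr .height u := by
  refine Halts.mono (halts_forLoop (n := s.reg .nx + s.reg .ny)
    (fun k s' => ∀ v ≤ k, s'.arr .off v = ∑ u ∈ Finset.range v, s.arr .height u)
    (fun _ => 100) ?_ ?_ ?_) ?_ fun s' h => h
  · simpa using hs
  · intro j s' hf _
    simp [hf.1 .nx rfl, hf.1 .ny rfl]
  · intro j hj s' hf hI hj'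
    refine (Halts.of_loopFree rfl s' (Q := fun s'' => s''.reg .v = j ∧ _) ?_).mono (by decide)
      fun s' h => h
    simp only [Cmd.run, Expr.eval_get, Expr.eval_add, Expr.eval_one, eval_r, hj',
      hf.2 .height rfl, State.setReg_arr, State.setArr_arr_self, State.setArr_reg, true_and]
    intro v hv
    rcases Nat.lt_or_ge j v with h | h
    · obtain rfl : v = j + 1 := by omega
      rw [Function.update_self, hI j le_rfl, Finset.sum_range_succ]
    · rw [Function.update_of_ne (by omega), hI v h]
  · simp only [Finset.sum_const, Finset.card_range, smul_eq_mul, Expr.cost]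
    omega

/-- `L` is the list of the values of `dest` on the linked list that starts at `h`, all of whose
cells have numbers at most `B`. -/
def IsListAt (B : ℕ) (next dest : ℕ → ℕ) : ℕ → List ℕ → Prop
  | h, [] => h = 0
  | h, b :: L => h ≠ 0 ∧ h ≤ B ∧ dest h = b ∧ IsListAt B next dest (next h) L

/-- The written cell B + 1 is fresh, since the list uses only cells up to B. -/
theorem IsListAt.update {B : ℕ} {next dest : ℕ → ℕ} (k l : ℕ) :
    ∀ {h : ℕ} {L : List ℕ}, IsListAt B next dest h L →
      IsListAt (B + 1) (Function.update next (B + 1) k) (Function.update dest (B + 1) l) h L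
  | _, [], h => h
  | h, b :: L, ⟨h1, h2, h3, h4⟩ => by
    refine ⟨h1, by omega, ?_, ?_⟩
    · rw [Function.update_of_ne (by omega), h3]
    · rw [Function.update_of_ne (by omega)]
      exact h4.update k l

/-- The second components of the pairs in `A` with first component `a`. -/
def successors (A : List (ℕ × ℕ)) (a : ℕ) : List ℕ :=
  (A.filter fun e => e.1 = a).map Prod.snd

theorem mem_successors {A : List (ℕ × ℕ)} {a b : ℕ} : b ∈ successors A a ↔ (a, b) ∈ A := by
  simp [successors]

theorem successors_cons (A : List (ℕ × ℕ)) (a b c : ℕ) :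
    successors ((a, b) :: A) c = if c = a then b :: successors A c else successors A c := by
  by_cases h : a = c
  · simp [successors, h]
  · simp [successors, h, Ne.symm h]

/-- Gives the initial value of the arc part of the search potential. -/
theorem sum_length_successors {A : List (ℕ × ℕ)} {C : ℕ} (h : ∀ e ∈ A, e.1 < C) :
    ∑ a ∈ Finset.range C, (successors A a).length = A.length := by
  induction A with
  | nil => simp [successors]
  | cons e A ih =>
    obtain ⟨a, b⟩ := e
    simp only [List.mem_cons, forall_eq_or_imp] at h
    have h1 : ∀ c, (successors ((a, b) :: A) c).length =
        (successors A c).length + if c = a then 1 else 0 := by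
      intro c
      rw [successors_cons]
      split_ifs <;> simp
    rw [Finset.sum_congr rfl fun c _ => h1 c, Finset.sum_add_distrib, ih h.2]
    simp [h.1]

/-- The adjacency lists in the state `s` represent the arcs in `A`. -/
def HasArcs (A : List (ℕ × ℕ)) (s : State Reg Arr) : Prop :=
  s.reg .arcs = A.length ∧
    ∀ a, IsListAt A.length (s.arr .next) (s.arr .dest) (s.arr .head a) (successors A a)

/-- The array `mate` in the state `s` represents the pairs in `B`. -/
def HasMates (B : List (ℕ × ℕ)) (s : State Reg Arr) : Prop :=
  ∀ a, s.arr .mate a = ((B.lookup a).map (· + 1)).getD 0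

theorem lookup_cons_eq_ite (a b c : ℕ) (B : List (ℕ × ℕ)) :
    List.lookup c ((a, b) :: B) = if c = a then some b else B.lookup c := by
  by_cases h : c = a
  · simp [h]
  · have : (c == a) = false := by simpa using h
    simp [List.lookup_cons, this, h]

theorem HasArcs.addArc {A : List (ℕ × ℕ)} {s : State Reg Arr} (h : HasArcs A s) {a b : Reg}
    (ha : a ≠ .arcs) (hb : b ≠ .arcs) :
    HasArcs ((s.reg a, s.reg b) :: A) ((AllCavity.addArc a b).run s) := by
  obtain ⟨h1, h2⟩ := h
  refine ⟨by simp [AllCavity.addArc, Cmd.run, h1], fun c => ?_⟩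
  simp only [AllCavity.addArc, Cmd.run, State.setArr_arr, State.setReg_arr, State.setReg_reg,
    State.setArr_reg, eval_r, Expr.eval_add, Expr.eval_one, Expr.eval_get, ha, hb, h1,
    successors_cons, List.length_cons, reduceCtorEq, if_true, if_false]
  by_cases hc : c = s.reg a
  · rw [if_pos hc, hc, Function.update_self]
    refine ⟨by omega, le_rfl, Function.update_self .., ?_⟩
    rw [Function.update_self]
    exact (h2 _).update _ _
  · rw [if_neg hc, Function.update_of_ne hc]
    exact (h2 _).update _ _

/-- The loop body that adds one edge of the unfolded graph. -/
def addCopy : Cmd Reg Arr :=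
  .a ≔ r .x + r .i ;;
  .b ≔ r .y + (r .w - (r .i + 1)) ;;
  addArc .a .b ;;
  addArc .b .a ;;
  .ite (.get .em (r .e))
    (.store .mate (r .a) (r .b + 1) ;;
     .store .mate (r .b) (r .a + 1))
    .skip

/-- The loop body that unfolds one edge. -/
def unfoldEdge : Cmd Reg Arr :=
  .x ≔ .get .off (.get .ex (r .e)) ;;
  .y ≔ .get .off (r .nx + .get .ey (r .e)) ;;
  .w ≔ .get .ew (r .e) ;;
  forLoop .i (r .w) addCopy

theorem unfoldGraph_eq :
    unfoldGraph = (findHeights ;; numberCopies ;; forLoop .e (r .m) unfoldEdge) := rfl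

/-- The arcs for the first `n` copies of an edge of weight `w`. -/
def copyArcs (x y w : ℕ) : ℕ → List (ℕ × ℕ)
  | 0 => []
  | n + 1 => (y + (w - (n + 1)), x + n) :: (x + n, y + (w - (n + 1))) :: copyArcs x y w n

theorem mem_copyArcs {x y w n a b : ℕ} : (a, b) ∈ copyArcs x y w n ↔
    ∃ i < n, (a = x + i ∧ b = y + (w - (i + 1))) ∨ (b = x + i ∧ a = y + (w - (i + 1))) := by
  induction n with
  | zero => simp [copyArcs]
  | succ n ih =>
    simp only [copyArcs, List.mem_cons, ih, Prod.mk.injEq]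
    constructor
    · rintro (h | h | ⟨i, hi, h⟩)
      · exact ⟨n, by omega, .inr ⟨h.2, h.1⟩⟩
      · exact ⟨n, by omega, .inl h⟩
      · exact ⟨i, by omega, h⟩
    · rintro ⟨i, hi, h⟩
      rcases Nat.lt_succ_iff_lt_or_eq.1 hi with hi | rfl
      · exact .inr (.inr ⟨i, hi, h⟩)
      · rcases h with h | h
        · exact .inr (.inl h)
        · exact .inl ⟨h.2, h.1⟩

theorem length_copyArcs (x y w n : ℕ) : (copyArcs x y w n).length = 2 * n := by
  induction n with
  | zero => rfl
  | succ n ih => simp only [copyArcs, List.length_cons, ih]; omega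

/-- `lookup` finds the foremost pair, as `mate` holds the last value stored. The order of the two
pairs in `copyArcs` agrees with the order of the two stores. -/
theorem addCopy_run {A B : List (ℕ × ℕ)} {s : State Reg Arr} {i : ℕ}
    (hA : HasArcs (copyArcs (s.reg .x) (s.reg .y) (s.reg .w) i ++ A) s)
    (hB : HasMates ((if s.arr .em (s.reg .e) ≠ 0 then
      copyArcs (s.reg .x) (s.reg .y) (s.reg .w) i else []) ++ B) s) (hi : s.reg .i = i) :
    HasArcs (copyArcs (s.reg .x) (s.reg .y) (s.reg .w) (i + 1) ++ A) (addCopy.run s) ∧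
    HasMates ((if s.arr .em (s.reg .e) ≠ 0 then
      copyArcs (s.reg .x) (s.reg .y) (s.reg .w) (i + 1) else []) ++ B) (addCopy.run s) := by
  set s₁ := (s.setReg .a (s.reg .x + i)).setReg .b (s.reg .y + (s.reg .w - (i + 1))) with hs₁
  set s₂ := (addArc .b .a).run ((addArc .a .b).run s₁) with hs₂
  have hrun : addCopy.run s = if s.arr .em (s.reg .e) = 0 then s₂ else
      (s₂.setArr .mate (s₁.reg .a) (s₁.reg .b + 1)).setArr .mate (s₁.reg .b) (s₁.reg .a + 1) := by
    simp [addCopy, Cmd.run, hi, hs₁, hs₂, addArc, State.setArr_arr]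
  have h1 : HasArcs (copyArcs (s.reg .x) (s.reg .y) (s.reg .w) i ++ A) s₁ := by
    simpa [HasArcs, hs₁] using hA
  have h2 : HasArcs (copyArcs (s.reg .x) (s.reg .y) (s.reg .w) (i + 1) ++ A) s₂ := by
    have := (h1.addArc (a := .a) (b := .b) (by decide) (by decide)).addArc (a := .b) (b := .a)
      (by decide) (by decide)
    rw [← hs₂] at this
    have e1 : ((addArc .a .b).run s₁).reg .a = s₁.reg .a := by simp [addArc, Cmd.run]
    have e2 : ((addArc .a .b).run s₁).reg .b = s₁.reg .b := by simp [addArc, Cmd.run]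
    rw [e1, e2] at this
    simpa [copyArcs, hs₁] using this
  have hm : s₂.arr .mate = s.arr .mate := by
    simp [hs₂, hs₁, addArc, Cmd.run, State.setArr_arr]
  refine ⟨?_, fun a => ?_⟩
  · rw [hrun]
    split_ifs
    · exact h2
    · simpa [HasArcs, State.setArr_arr] using h2
  · have := hB a
    rw [hrun]
    by_cases he : s.arr .em (s.reg .e) = 0
    · simpa [he, hm] using this
    · simp only [he, ne_eq, not_false_iff, if_true, if_false] at this ⊢
      simp only [State.setArr_arr_self, copyArcs, hm, Function.update_apply, List.cons_append,
        lookup_cons_eq_ite, hs₁, State.setReg_reg, reduceCtorEq, if_true, if_false]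
      split_ifs
      · rfl
      · rfl
      · exact this

end AllCavity

namespace AllCavity

open RAM

theorem unfoldEdge_halts {A B : List (ℕ × ℕ)} {s : State Reg Arr} {x y w : ℕ}
    (hA : HasArcs A s) (hB : HasMates B s) (hx : x = s.arr .off (s.arr .ex (s.reg .e)))
    (hy : y = s.arr .off (s.reg .nx + s.arr .ey (s.reg .e))) (hw : w = s.arr .ew (s.reg .e)) :
    Halts unfoldEdge s (1000 * (w + 1)) fun s' => Frame unfoldEdge s s' ∧
      HasArcs (copyArcs x y w w ++ A) s' ∧
      HasMates ((if s.arr .em (s.reg .e) ≠ 0 then copyArcs x y w w else []) ++ B) s' := by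
  refine Halts.frame (Q := fun s' => HasArcs (copyArcs x y w w ++ A) s' ∧
      HasMates ((if s.arr .em (s.reg .e) ≠ 0 then copyArcs x y w w else []) ++ B) s') ?_
  refine Halts.mono ((Halts.of_loopFree (c := .x ≔ .get .off (.get .ex (r .e))) rfl s
    (Q := fun s' => s' = s.setReg .x x) (by simp [Cmd.run, hx])).seq fun s₁ h₁ =>
    (Halts.of_loopFree (c := .y ≔ .get .off (r .nx + .get .ey (r .e))) rfl s₁
    (Q := fun s' => s' = (s.setReg .x x).setReg .y y) (by simp [Cmd.run, hy, h₁])).seq fun s₂ h₂ =>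
    (Halts.of_loopFree (c := .w ≔ .get .ew (r .e)) rfl s₂
    (Q := fun s' => s' = ((s.setReg .x x).setReg .y y).setReg .w w)
      (by simp [Cmd.run, hw, h₂])).seq fun s₃ h₃ =>
    (halts_forLoop (n := w) (fun i s' => HasArcs (copyArcs x y w i ++ A) s' ∧
      HasMates ((if s.arr .em (s.reg .e) ≠ 0 then copyArcs x y w i else []) ++ B) s')
      (fun _ => 200) ?_ ?_ ?_).mono le_rfl fun s' h => h.2) ?_ fun s' h => h
  · subst h₃
    exact ⟨by simpa [HasArcs, copyArcs] using hA, by simpa [HasMates, copyArcs] using hB⟩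
  · intro j s' hf _
    simp [hf.1 .w rfl, h₃]
  · intro j hj s' hf hI hj'
    refine (Halts.of_loopFree rfl s' (Q := fun s'' => s''.reg .i = j ∧ _) ?_).mono (by decide)
      fun s' h => h
    have e1 := hf.1 .x rfl
    have e2 := hf.1 .y rfl
    have e3 := hf.1 .w rfl
    have e4 := hf.1 .e rfl
    have e5 := hf.2 .em rfl
    simp only [h₃, State.setReg_reg, State.setReg_arr, reduceCtorEq, if_true, if_false]
      at e1 e2 e3 e4 e5
    have := addCopy_run (s := s') (i := j) (A := A) (B := B) (by rw [e1, e2, e3]; exact hI.1)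
      (by rw [e1, e2, e3, e4, e5]; exact hI.2) hj'
    rw [e1, e2, e3, e4, e5] at this
    refine ⟨?_, ?_, ?_⟩
    · exact ((Cmd.run_frame rfl s').1 .i rfl).trans hj'
    · simpa [HasArcs] using this.1
    · simpa [HasMates] using this.2
  · simp only [Finset.sum_const, Finset.card_range, smul_eq_mul, Expr.cost, Cmd.bound]
    have : (r .nx + .get .ey (r .e) : Expr Reg Arr).cost = 4 := rfl
    omega

/-- The arcs for the first `n` edges that satisfy `P`, where the copies of the ends of the `j`-th
edge are numbered from `x j` and `y j` on and `w j` is its weight. -/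
def edgeArcs (x y w : ℕ → ℕ) (P : ℕ → Prop) [DecidablePred P] : ℕ → List (ℕ × ℕ)
  | 0 => []
  | j + 1 => (if P j then copyArcs (x j) (y j) (w j) (w j) else []) ++ edgeArcs x y w P j

theorem mem_edgeArcs {x y w : ℕ → ℕ} {P : ℕ → Prop} [DecidablePred P] {n a b : ℕ} :
    (a, b) ∈ edgeArcs x y w P n ↔
      ∃ j < n, P j ∧ (a, b) ∈ copyArcs (x j) (y j) (w j) (w j) := by
  induction n with
  | zero => simp [edgeArcs]
  | succ n ih =>
    rw [edgeArcs, List.mem_append, ih]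
    constructor
    · rintro (h | ⟨j, hj, h⟩)
      · split_ifs at h with hP
        · exact ⟨n, by omega, hP, h⟩
        · simp at h
      · exact ⟨j, by omega, h⟩
    · rintro ⟨j, hj, hP, h⟩
      rcases Nat.lt_succ_iff_lt_or_eq.1 hj with hj | rfl
      · exact .inr ⟨j, hj, hP, h⟩
      · exact .inl (by rwa [if_pos hP])

theorem length_edgeArcs (x y w : ℕ → ℕ) (n : ℕ) :
    (edgeArcs x y w (fun _ => True) n).length = 2 * ∑ j ∈ Finset.range n, w j := by
  induction n with
  | zero => rfl
  | succ n ih =>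
    rw [edgeArcs, List.length_append, ih, if_pos trivial, length_copyArcs, Finset.sum_range_succ]
    omega

theorem unfoldGraph_halts (s : State Reg Arr) (hheight : ∀ v, s.arr .height v = 0)
    (hoff : s.arr .off 0 = 0) (harcs : s.reg .arcs = 0) (hhead : ∀ v, s.arr .head v = 0)
    (hmate : ∀ v, s.arr .mate v = 0) :
    Halts unfoldGraph s (4000 * (s.reg .m + (s.reg .nx + s.reg .ny) +
        ∑ j ∈ Finset.range (s.reg .m), s.arr .ew j + 1)) fun s' => Frame unfoldGraph s s' ∧
      (∀ v, s'.arr .height v = (Finset.range (s.reg .m)).sup fun j =>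
        if s.arr .ex j = v ∨ s.reg .nx + s.arr .ey j = v then s.arr .ew j else 0) ∧
      (∀ v ≤ s.reg .nx + s.reg .ny, s'.arr .off v = ∑ u ∈ Finset.range v, s'.arr .height u) ∧
      HasArcs (edgeArcs (fun j => s'.arr .off (s.arr .ex j))
        (fun j => s'.arr .off (s.reg .nx + s.arr .ey j)) (s.arr .ew) (fun _ => True)
        (s.reg .m)) s' ∧
      HasMates (edgeArcs (fun j => s'.arr .off (s.arr .ex j))
        (fun j => s'.arr .off (s.reg .nx + s.arr .ey j)) (s.arr .ew) (fun j => s.arr .em j ≠ 0)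
        (s.reg .m)) s' := by
  refine Halts.frame (Q := fun s' =>
      (∀ v, s'.arr .height v = (Finset.range (s.reg .m)).sup fun j =>
        if s.arr .ex j = v ∨ s.reg .nx + s.arr .ey j = v then s.arr .ew j else 0) ∧
      (∀ v ≤ s.reg .nx + s.reg .ny, s'.arr .off v = ∑ u ∈ Finset.range v, s'.arr .height u) ∧
      HasArcs (edgeArcs (fun j => s'.arr .off (s.arr .ex j))
        (fun j => s'.arr .off (s.reg .nx + s.arr .ey j)) (s.arr .ew) (fun _ => True)
        (s.reg .m)) s' ∧
      HasMates (edgeArcs (fun j => s'.arr .off (s.arr .ex j))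
        (fun j => s'.arr .off (s.reg .nx + s.arr .ey j)) (s.arr .ew) (fun j => s.arr .em j ≠ 0)
        (s.reg .m)) s') ?_
  rw [unfoldGraph_eq]
  -- The 8 and the 6 are the overheads `bound.cost + 7` and `bound.cost + 5` of a counting loop with
  -- a bound of cost 1. The other constants are generous.
  refine Halts.mono ((findHeights_halts s hheight).seq (T₂ := 1000 * (s.reg .nx + s.reg .ny + 1) +
    (∑ j ∈ Finset.range (s.reg .m), (1000 * (s.arr .ew j + 1) + 8) + 6))
    fun s₁ ⟨f₁, h₁⟩ => ?_) ?_ fun s' h => h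
  · have hn := numberCopies_halts s₁ (by rw [f₁.2 .off rfl, hoff])
    rw [f₁.1 .nx rfl, f₁.1 .ny rfl] at hn
    refine hn.seq fun s₂ ⟨f₂, h₂⟩ => ?_
    have hh : s₂.arr .height = s₁.arr .height := f₂.2 .height rfl
    have g : ∀ x, findHeights.writesReg x = false → numberCopies.writesReg x = false →
        s₂.reg x = s.reg x := fun x h h' => (f₂.1 x h').trans (f₁.1 x h)
    have g' : ∀ x, findHeights.writesArr x = false → numberCopies.writesArr x = false →
        s₂.arr x = s.arr x := fun x h h' => (f₂.2 x h').trans (f₁.2 x h)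
    refine (halts_forLoop (n := s.reg .m) (fun j s' =>
      HasArcs (edgeArcs (fun j => s₂.arr .off (s.arr .ex j))
        (fun j => s₂.arr .off (s.reg .nx + s.arr .ey j)) (s.arr .ew) (fun _ => True) j) s' ∧
      HasMates (edgeArcs (fun j => s₂.arr .off (s.arr .ex j))
        (fun j => s₂.arr .off (s.reg .nx + s.arr .ey j)) (s.arr .ew) (fun j => s.arr .em j ≠ 0)
        j) s') (fun j => 1000 * (s.arr .ew j + 1)) ?_ ?_ ?_).mono (le_of_eq rfl) ?_
    · simp [HasArcs, HasMates, edgeArcs, successors, IsListAt, g .arcs rfl rfl, g' .head rfl rfl,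
        g' .mate rfl rfl, harcs, hhead, hmate]
    · intro j s' hf _
      simp [hf.1 .m rfl, g .m rfl rfl]
    · intro j hj s' hf hI hj'
      have e1 := (hf.1 .nx rfl).trans (g .nx rfl rfl)
      have e2 := (hf.2 .ex rfl).trans (g' .ex rfl rfl)
      have e3 := (hf.2 .ey rfl).trans (g' .ey rfl rfl)
      have e4 := (hf.2 .ew rfl).trans (g' .ew rfl rfl)
      have e5 := (hf.2 .em rfl).trans (g' .em rfl rfl)
      have e6 := hf.2 .off rfl
      have := unfoldEdge_halts hI.1 hI.2 rfl rfl rfl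
      rw [hj', e1, e2, e3, e4, e5, e6] at this
      refine this.mono le_rfl fun s'' ⟨h1, h2, h3⟩ => ⟨(h1.1 .e rfl).trans hj', ?_, ?_⟩
      · simpa [HasArcs, edgeArcs] using h2
      · simpa only [HasMates, edgeArcs, State.setReg_arr] using h3
    · rintro s' ⟨hf, h3, h4⟩
      have e1 := hf.2 .off rfl
      have e2 := (hf.2 .height rfl).trans hh
      rw [e1, e2]
      exact ⟨h₁, h₂, h3, h4⟩
  · rw [Finset.sum_add_distrib, ← Finset.mul_sum, Finset.sum_add_distrib]
    simp only [Finset.sum_const, Finset.card_range, smul_eq_mul]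
    omega

end AllCavity

/-! ### Correctness and running time of the depth-first search. -/

namespace AllCavity

open RAM

/-- The nodes that the search has to mark, in the graph with nodes `0, …, C - 1`, arcs `A` and
matching `mate`. -/
inductive Marked (A : List (ℕ × ℕ)) (mate : ℕ → ℕ) (C : ℕ) : ℕ → Prop
  | unmatched {v : ℕ} : v < C → mate v = 0 → Marked A mate C v
  | step {a b c : ℕ} : Marked A mate C a → (a, b) ∈ A → mate b = c + 1 → Marked A mate C c

/-- The invariant of the search; `D a` is the unprocessed part of the adjacency list of `a`. -/
structure SearchInv (A : List (ℕ × ℕ)) (mate next dest : ℕ → ℕ) (C : ℕ) (D : ℕ → List ℕ)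
    (sp : ℕ) (stack head rho : ℕ → ℕ) : Prop where
  lists : ∀ a, IsListAt A.length next dest (head a) (D a)
  rho_le : ∀ a, rho a ≤ 1
  sound : ∀ a < C, rho a = 0 → Marked A mate C a
  unmatched : ∀ a < C, mate a = 0 → rho a = 0
  stack_lt : ∀ t < sp, stack t < C
  stack_rho : ∀ t < sp, rho (stack t) = 0
  closed : ∀ a < C, rho a = 0 → ∀ b ∈ successors A a, b ∉ D a → ∀ c, mate b = c + 1 → rho c = 0
  full : ∀ a < C, rho a ≠ 0 → D a = successors A a
  active : ∀ a < C, rho a = 0 → D a = [] ∨ ∃ t < sp, stack t = a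
  sub : ∀ a, ∀ b ∈ D a, b ∈ successors A a

/-- The potential of the search. -/
def potential (C : ℕ) (D : ℕ → List ℕ) (sp : ℕ) (rho : ℕ → ℕ) : ℕ :=
  ∑ a ∈ Finset.range C, (D a).length + sp + ∑ a ∈ Finset.range C, rho a

theorem sum_range_update_lt {C i : ℕ} (hi : i < C) {α : Type} (f : ℕ → α) (g : α → ℕ) {x : α}
    (hx : g x < g (f i)) :
    ∑ a ∈ Finset.range C, g (Function.update f i x a) < ∑ a ∈ Finset.range C, g (f a) := by
  refine Finset.sum_lt_sum (fun a _ => ?_) ⟨i, Finset.mem_range.2 hi, by simpa using hx⟩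
  rcases eq_or_ne a i with rfl | h
  · simpa using hx.le
  · simp [h]

namespace SearchInv

variable {A : List (ℕ × ℕ)} {mate next dest : ℕ → ℕ} {C : ℕ} {D : ℕ → List ℕ} {sp : ℕ}
  {stack head rho : ℕ → ℕ}

/-- The popped node needs no place on the stack: its head is 0, so its list is exhausted. -/
theorem pop (h : SearchInv A mate next dest C D (sp + 1) stack head rho)
    (h0 : head (stack sp) = 0) :
    SearchInv A mate next dest C D sp stack head rho where
  lists := h.lists
  rho_le := h.rho_le
  sound := h.sound
  unmatched := h.unmatched
  stack_lt t ht := h.stack_lt t (by omega)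
  stack_rho t ht := h.stack_rho t (by omega)
  closed := h.closed
  full := h.full
  sub := h.sub
  active a ha hr := by
    rcases h.active a ha hr with hD | ⟨t, ht, hta⟩
    · exact .inl hD
    · rcases Nat.lt_succ_iff_lt_or_eq.1 ht with ht | rfl
      · exact .inr ⟨t, ht, hta⟩
      · left
        have := h.lists a
        rw [← hta, h0, hta] at this
        cases hDa : D a with
        | nil => rfl
        | cons b L =>
          rw [hDa] at this
          exact (this.1 rfl).elim

theorem exists_cons (h : SearchInv A mate next dest C D sp stack head rho) {a : ℕ}
    (ha : head a ≠ 0) :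
    ∃ L, D a = dest (head a) :: L ∧ IsListAt A.length next dest (next (head a)) L := by
  have := h.lists a
  cases hDa : D a with
  | nil =>
    rw [hDa] at this
    exact (ha this).elim
  | cons b L =>
    rw [hDa] at this
    obtain ⟨-, -, rfl, h4⟩ := this
    exact ⟨L, rfl, h4⟩

/-- Processing an arc that leads to no unmarked node. -/
theorem advance (h : SearchInv A mate next dest C D sp stack head rho) {a : ℕ} {L : List ℕ}
    (hr : rho a = 0) (hD : D a = dest (head a) :: L)
    (hL : IsListAt A.length next dest (next (head a)) L)
    (hc : ∀ c, mate (dest (head a)) = c + 1 → rho c = 0) :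
    SearchInv A mate next dest C (Function.update D a L) sp stack
      (Function.update head a (next (head a))) rho where
  lists a' := by
    rcases eq_or_ne a' a with rfl | h'
    · simpa using hL
    · simpa [h'] using h.lists a'
  rho_le := h.rho_le
  sound := h.sound
  unmatched := h.unmatched
  stack_lt := h.stack_lt
  stack_rho := h.stack_rho
  closed a' ha' hr' b hb hbD c hbc := by
    rcases eq_or_ne a' a with rfl | h'
    · rw [Function.update_self] at hbD
      rcases eq_or_ne b (dest (head a')) with rfl | h''
      · exact hc c hbc
      · exact h.closed a' ha' hr' b hb (by simp [hD, h'', hbD]) c hbc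
    · rw [Function.update_of_ne h'] at hbD
      exact h.closed a' ha' hr' b hb hbD c hbc
  full a' ha' hr' := by
    have : a' ≠ a := by
      rintro rfl
      exact hr' hr
    rw [Function.update_of_ne this]
    exact h.full a' ha' hr'
  active a' ha' hr' := by
    rcases eq_or_ne a' a with rfl | h'
    · rcases h.active a' ha' hr' with h1 | h1
      · simp [hD] at h1
      · exact .inr h1
    · rw [Function.update_of_ne h']
      exact h.active a' ha' hr'
  sub a' b hb := by
    rcases eq_or_ne a' a with rfl | h'
    · rw [Function.update_self] at hb
      exact h.sub a' b (by simp [hD, hb])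
    · rw [Function.update_of_ne h'] at hb
      exact h.sub a' b hb

/-- Processing an arc that leads to the unmarked node `c`. -/
theorem advance_push (h : SearchInv A mate next dest C D sp stack head rho) {a c : ℕ} {L : List ℕ}
    (ha : a < C) (hr : rho a = 0) (hD : D a = dest (head a) :: L)
    (hL : IsListAt A.length next dest (next (head a)) L)
    (hc : mate (dest (head a)) = c + 1) (hcC : c < C) (hrc : rho c ≠ 0) :
    SearchInv A mate next dest C (Function.update D a L) (sp + 1) (Function.update stack sp c)
      (Function.update head a (next (head a))) (Function.update rho c 0) where
  lists a' := by
    rcases eq_or_ne a' a with rfl | h'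
    · simpa using hL
    · simpa [h'] using h.lists a'
  rho_le a' := by
    rw [Function.update_apply]
    split_ifs
    · exact zero_le_one
    · exact h.rho_le a'
  sound a' ha' hr' := by
    rcases eq_or_ne a' c with rfl | h'
    · exact .step (h.sound a ha hr) (mem_successors.1 (h.sub a _ (by simp [hD]))) hc
    · rw [Function.update_of_ne h'] at hr'
      exact h.sound a' ha' hr'
  unmatched a' ha' hm := by
    rw [Function.update_apply, h.unmatched a' ha' hm, ite_self]
  stack_lt t ht := by
    rcases eq_or_ne t sp with rfl | h'
    · simpa using hcC
    · rw [Function.update_of_ne h']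
      exact h.stack_lt t (by omega)
  stack_rho t ht := by
    rcases eq_or_ne t sp with rfl | h'
    · simp
    · rw [Function.update_of_ne h', Function.update_apply, h.stack_rho t (by omega), ite_self]
  closed a' ha' hr' b hb hbD c' hbc := by
    rw [Function.update_apply]
    split_ifs with hcc
    · rfl
    rcases eq_or_ne a' a with rfl | h'
    · rw [Function.update_self] at hbD
      rcases eq_or_ne b (dest (head a')) with rfl | h''
      · exact (hcc (by omega)).elim
      · exact h.closed a' ha' hr b hb (by simp [hD, h'', hbD]) c' hbc
    · rw [Function.update_of_ne h'] at hbD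
      rcases eq_or_ne a' c with rfl | h''
      -- The list of `c` was untouched while `c` was unmarked, so none of its arcs counts as
      -- processed yet.
      · rw [h.full a' ha' hrc] at hbD
        exact (hbD hb).elim
      · rw [Function.update_of_ne h''] at hr'
        exact h.closed a' ha' hr' b hb hbD c' hbc
  full a' ha' hr' := by
    have h1 : a' ≠ c := by
      rintro rfl
      simp at hr'
    rw [Function.update_of_ne h1] at hr'
    have h2 : a' ≠ a := by
      rintro rfl
      exact hr' hr
    rw [Function.update_of_ne h2]
    exact h.full a' ha' hr'
  active a' ha' hr' := by
    rcases eq_or_ne a' c with rfl | h1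
    · exact .inr ⟨sp, by omega, by simp⟩
    · rw [Function.update_of_ne h1] at hr'
      have hst : (∃ t < sp, stack t = a') → ∃ t < sp + 1, Function.update stack sp c t = a' := by
        rintro ⟨t, ht, hta⟩
        exact ⟨t, by omega, by rw [Function.update_of_ne (by omega), hta]⟩
      rcases eq_or_ne a' a with rfl | h'
      · rcases h.active a' ha' hr' with h1 | h1
        · simp [hD] at h1
        · exact .inr (hst h1)
      · rw [Function.update_of_ne h']
        exact (h.active a' ha' hr').imp id hst
  sub a' b hb := by
    rcases eq_or_ne a' a with rfl | h'
    · rw [Function.update_self] at hb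
      exact h.sub a' b (by simp [hD, hb])
    · rw [Function.update_of_ne h'] at hb
      exact h.sub a' b hb

/-- With an empty stack, `active` says that every marked node has used up its list, so by `closed`
the marked set is closed under search steps. -/
theorem rho_eq_zero_iff (h : SearchInv A mate next dest C D 0 stack head rho)
    (hA : ∀ e ∈ A, e.1 < C) {a : ℕ} (ha : a < C) :
    rho a = 0 ↔ Marked A mate C a := by
  refine ⟨h.sound a ha, fun hm => ?_⟩
  clear ha
  induction hm with
  | unmatched hv h0 => exact h.unmatched _ hv h0
  | @step a b c _ hab hbc ih =>
    have ha := hA _ hab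
    rcases h.active a ha ih with hD | ⟨t, ht, -⟩
    · exact h.closed a ha ih b (mem_successors.2 hab) (by simp [hD]) c hbc
    · omega

end SearchInv

/-- The loop body that puts an unmatched node on the stack. -/
def initSearch : Cmd Reg Arr :=
  .ite (.get .mate (r .v))
    (.store .rho (r .v) 1)
    (push (r .v))

/-- The loop body of the search. -/
def searchStep : Cmd Reg Arr :=
  .a ≔ .get .stack (r .sp - 1) ;;
  .k ≔ .get .head (r .a) ;;
  .ite (r .k)
    (.store .head (r .a) (.get .next (r .k)) ;;
     .b ≔ .get .dest (r .k) ;;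
     .ite (.get .mate (r .b))
      (.c ≔ .get .mate (r .b) - 1 ;;
       .ite (.get .rho (r .c))
        (.store .rho (r .c) 0 ;;
         push (r .c))
        .skip)
      .skip)
    (.sp ≔ r .sp - 1)

theorem search_eq : search =
    (forLoop .v (.get .off (r .nx + r .ny)) initSearch ;; .while (r .sp) searchStep) := rfl

/-- Each round lowers the potential: a pop lowers the stack, any other round uses up an arc, and a
push is paid for by the value of `rho` that drops from 1 to 0. -/
theorem searchStep_inv {A : List (ℕ × ℕ)} {mate next dest : ℕ → ℕ} {C : ℕ}
    (hmate : ∀ b c, mate b = c + 1 → c < C) {D : ℕ → List ℕ} {s : State Reg Arr}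
    (h : SearchInv A mate next dest C D (s.reg .sp) (s.arr .stack) (s.arr .head) (s.arr .rho))
    (hm : s.arr .mate = mate) (hn : s.arr .next = next) (hd : s.arr .dest = dest)
    (hsp : s.reg .sp ≠ 0) :
    ∃ D', SearchInv A mate next dest C D' ((searchStep.run s).reg .sp)
        ((searchStep.run s).arr .stack) ((searchStep.run s).arr .head)
        ((searchStep.run s).arr .rho) ∧
      potential C D' ((searchStep.run s).reg .sp) ((searchStep.run s).arr .rho) <
        potential C D (s.reg .sp) (s.arr .rho) := by
  obtain ⟨sp, hsp'⟩ := Nat.exists_eq_succ_of_ne_zero hsp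
  rw [hsp'] at h
  set a := s.arr .stack sp with ha
  have haC : a < C := h.stack_lt sp (by omega)
  have hra : s.arr .rho a = 0 := h.stack_rho sp (by omega)
  by_cases h0 : s.arr .head a = 0
  · have hrun : searchStep.run s = ((s.setReg .a a).setReg .k 0).setReg .sp sp := by
      simp [searchStep, Cmd.run, hsp', ← ha, h0]
    rw [hrun]
    refine ⟨D, by simpa using h.pop h0, ?_⟩
    simp [potential, hsp']
  · obtain ⟨L, hD, hL⟩ := h.exists_cons h0
    have hlen : ∑ x ∈ Finset.range C, (Function.update D a L x).length <
        ∑ x ∈ Finset.range C, (D x).length :=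
      sum_range_update_lt haC D List.length (by simp [hD])
    set b := dest (s.arr .head a) with hb
    let s₂ := (((s.setReg .a a).setReg .k (s.arr .head a)).setArr .head a
      (next (s.arr .head a))).setReg .b b
    by_cases hmb : mate b = 0
    · have hrun : searchStep.run s = s₂ := by
        simp [searchStep, Cmd.run, hsp', ← ha, h0, State.setArr_arr, hd, ← hb, hm, hmb, hn, s₂]
      rw [hrun]
      have hadv := h.advance hra hD hL (by simp [← hb, hmb])
      refine ⟨_, by simpa [s₂, State.setArr_arr, hsp'] using hadv, ?_⟩
      simp only [potential, s₂, State.setArr_arr, State.setReg_reg, State.setReg_arr,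
        State.setArr_reg, reduceCtorEq, if_false]
      omega
    · obtain ⟨c, hc⟩ := Nat.exists_eq_succ_of_ne_zero hmb
      have hcC := hmate b c hc
      by_cases hrc : s.arr .rho c = 0
      · have hrun : searchStep.run s = s₂.setReg .c c := by
          simp [searchStep, Cmd.run, hsp', ← ha, h0, State.setArr_arr, hd, ← hb, hm, hc, hn, s₂,
            hrc]
        rw [hrun]
        have hadv := h.advance hra hD hL fun c' hc' => by
          rw [← hb, hc] at hc'
          rw [← Nat.succ.inj hc', hrc]
        refine ⟨_, by simpa [s₂, State.setArr_arr, hsp'] using hadv, ?_⟩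
        simp only [potential, s₂, State.setArr_arr, State.setReg_reg, State.setReg_arr,
          State.setArr_reg, reduceCtorEq, if_false]
        omega
      · have hrun : searchStep.run s = (((s₂.setReg .c c).setArr .rho c 0).setArr .stack
            (sp + 1) c).setReg .sp (sp + 2) := by
          simp [searchStep, Cmd.run, hsp', ← ha, h0, State.setArr_arr, hd, ← hb, hm, hc, hn, s₂,
            hrc, push]
        rw [hrun]
        have hadv := h.advance_push haC hra hD hL hc hcC hrc
        refine ⟨_, by simpa [s₂, State.setArr_arr, hsp'] using hadv, ?_⟩
        have hsum : ∑ x ∈ Finset.range C, Function.update (s.arr .rho) c 0 x <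
            ∑ x ∈ Finset.range C, s.arr .rho x :=
          sum_range_update_lt hcC (s.arr .rho) id (Nat.pos_of_ne_zero hrc)
        simp only [potential, s₂, State.setArr_arr, State.setReg_reg, State.setReg_arr,
          State.setArr_reg, reduceCtorEq, if_false, if_true, hsp']
        omega

theorem initSearch_halts {s : State Reg Arr} {C : ℕ} (hC : s.arr .off (s.reg .nx + s.reg .ny) = C)
    (hrho : ∀ v, s.arr .rho v = 0) (hsp : s.reg .sp = 0) :
    Halts (forLoop .v (.get .off (r .nx + r .ny)) initSearch) s (1000 * (C + 1)) fun s' =>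
      Frame (forLoop .v (.get .off (r .nx + r .ny)) initSearch) s s' ∧
      (∀ v, s'.arr .rho v = if v < C ∧ s.arr .mate v ≠ 0 then 1 else 0) ∧
      s'.reg .sp ≤ C ∧
      (∀ t < s'.reg .sp, s'.arr .stack t < C ∧ s.arr .mate (s'.arr .stack t) = 0) ∧
      ∀ v < C, s.arr .mate v = 0 → ∃ t < s'.reg .sp, s'.arr .stack t = v := by
  refine (halts_forLoop (n := C) (fun j s' =>
      (∀ v, s'.arr .rho v = if v < j ∧ s.arr .mate v ≠ 0 then 1 else 0) ∧
      s'.reg .sp ≤ j ∧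
      (∀ t < s'.reg .sp, s'.arr .stack t < j ∧ s.arr .mate (s'.arr .stack t) = 0) ∧
      ∀ v < j, s.arr .mate v = 0 → ∃ t < s'.reg .sp, s'.arr .stack t = v)
      (fun _ => 100) ?_ ?_ ?_).mono ?_ fun s' h => h
  · simp [hrho, hsp]
  · intro j s' hf _
    simp [hf.1 .nx rfl, hf.1 .ny rfl, hf.2 .off rfl, hC]
  · intro j hj s' hf ⟨h1, h2, h3, h4⟩ hj'
    refine (Halts.of_loopFree rfl s' (Q := fun s'' => s''.reg .v = j ∧ _) ?_).mono (by decide)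
      fun s' h => h
    have e1 := hf.2 .mate rfl
    by_cases hm : s.arr .mate j = 0
    · have hrun : initSearch.run s' = (s'.setArr .stack (s'.reg .sp) j).setReg .sp
          (s'.reg .sp + 1) := by
        simp [initSearch, Cmd.run, e1, hj', hm, push]
      rw [hrun]
      simp only [State.setArr_arr, State.setReg_reg, State.setReg_arr, State.setArr_reg,
        reduceCtorEq, if_false, if_true, hj', true_and]
      refine ⟨fun v => ?_, by omega, fun t ht => ?_, fun v hv hv' => ?_⟩
      · rw [h1]
        rcases eq_or_ne v j with rfl | h
        · simp [hm]
        · have : v < j + 1 ↔ v < j := by omega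
          simp only [this]
      · rcases eq_or_ne t (s'.reg .sp) with rfl | h
        · simp [hm]
        · rw [Function.update_of_ne h]
          have := h3 t (by omega)
          exact ⟨by omega, this.2⟩
      · rcases Nat.lt_succ_iff_lt_or_eq.1 hv with hv | rfl
        · obtain ⟨t, ht, ht'⟩ := h4 v hv hv'
          exact ⟨t, by omega, by rw [Function.update_of_ne (by omega), ht']⟩
        · exact ⟨_, Nat.lt_succ_self _, Function.update_self ..⟩
    · have hrun : initSearch.run s' = s'.setArr .rho j 1 := by
        simp [initSearch, Cmd.run, e1, hj', hm]
      rw [hrun]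
      simp only [State.setArr_arr, State.setReg_reg, State.setReg_arr, State.setArr_reg,
        reduceCtorEq, if_false, if_true, hj', true_and]
      refine ⟨fun v => ?_, by omega, fun t ht => ?_, fun v hv hv' => ?_⟩
      · rcases eq_or_ne v j with rfl | h
        · simp [hm]
        · have : v < j + 1 ↔ v < j := by omega
          simp only [Function.update_of_ne h, h1, this]
      · have := h3 t ht
        exact ⟨by omega, this.2⟩
      · refine h4 v ?_ hv'
        have : v ≠ j := by
          rintro rfl
          exact hm hv'
        omega
  · have : (Expr.get .off (r .nx + r .ny) : Expr Reg Arr).cost = 4 := rfl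
    simp only [Finset.sum_const, Finset.card_range, smul_eq_mul, this]
    omega

theorem search_halts {A : List (ℕ × ℕ)} {s : State Reg Arr} {C : ℕ}
    (hC : s.arr .off (s.reg .nx + s.reg .ny) = C) (hA : HasArcs A s) (hAC : ∀ e ∈ A, e.1 < C)
    (hrho : ∀ v, s.arr .rho v = 0) (hsp : s.reg .sp = 0)
    (hmate : ∀ b c, s.arr .mate b = c + 1 → c < C) :
    Halts search s (4000 * (C + A.length + 1)) fun s' => Frame search s s' ∧
      ∀ v < C, s'.arr .rho v ≤ 1 ∧ (s'.arr .rho v = 0 ↔ Marked A (s.arr .mate) C v) := by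
  refine Halts.frame (Q := fun s' : State Reg Arr => ∀ v < C, s'.arr .rho v ≤ 1 ∧
    (s'.arr .rho v = 0 ↔ Marked A (s.arr .mate) C v)) ?_
  rw [search_eq]
  refine ((initSearch_halts hC hrho hsp).seq (T₂ := 1000 * (A.length + 2 * C) + 1000)
    fun s₁ ⟨hf, h1, h2, h3, h4⟩ => ?_).mono (by omega) fun s' h => h
  have hinv : SearchInv A (s.arr .mate) (s.arr .next) (s.arr .dest) C (successors A) (s₁.reg .sp)
      (s₁.arr .stack) (s₁.arr .head) (s₁.arr .rho) :=
    { lists := by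
        rw [hf.2 .head rfl]
        exact hA.2
      rho_le := fun a => by
        rw [h1]
        split_ifs <;> simp
      sound := fun a ha hr => by
        refine .unmatched ha ?_
        by_contra hm
        rw [h1, if_pos ⟨ha, hm⟩] at hr
        exact one_ne_zero hr
      unmatched := fun a ha hm => by simp [h1, hm]
      stack_lt := fun t ht => (h3 t ht).1
      stack_rho := fun t ht => by simp [h1, (h3 t ht).2]
      closed := fun a _ _ b hb hb' => (hb' hb).elim
      full := fun _ _ _ => rfl
      active := fun a ha hr => by
        refine .inr (h4 a ha ?_)
        by_contra hm
        rw [h1, if_pos ⟨ha, hm⟩] at hr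
        exact one_ne_zero hr
      sub := fun _ _ h => h }
  -- All arcs are unprocessed, and the stack and the sum of `rho` contribute at most C each.
  have hpot : potential C (successors A) (s₁.reg .sp) (s₁.arr .rho) ≤ A.length + 2 * C := by
    have : ∑ a ∈ Finset.range C, s₁.arr .rho a ≤ ∑ a ∈ Finset.range C, 1 :=
      Finset.sum_le_sum fun a _ => hinv.rho_le a
    simp only [Finset.sum_const, Finset.card_range, smul_eq_mul, mul_one] at this
    rw [potential, sum_length_successors hAC]
    omega
  refine (Halts.whileLoop (fun n s' => ∃ D, SearchInv A (s.arr .mate) (s.arr .next) (s.arr .dest) C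
    D (s'.reg .sp) (s'.arr .stack) (s'.arr .head) (s'.arr .rho) ∧
    potential C D (s'.reg .sp) (s'.arr .rho) = n ∧ s'.arr .mate = s.arr .mate ∧
    s'.arr .next = s.arr .next ∧ s'.arr .dest = s.arr .dest) 200 ?_ _ s₁
    ⟨_, hinv, rfl, hf.2 .mate rfl, hf.2 .next rfl, hf.2 .dest rfl⟩).mono ?_ ?_
  · rintro n s' ⟨D, hD, rfl, hm, hn, hd⟩ he
    refine (Halts.of_loopFree rfl s' ?_).mono (by decide) fun s' h => h
    obtain ⟨D', hD', hlt⟩ := searchStep_inv hmate hD hm hn hd he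
    have hfr := Cmd.run_frame (c := searchStep) rfl s'
    exact ⟨_, hlt, D', hD', rfl, (hfr.2 .mate rfl).trans hm, (hfr.2 .next rfl).trans hn,
      (hfr.2 .dest rfl).trans hd⟩
  · have : (r .sp : Expr Reg Arr).cost = 1 := rfl
    rw [this]
    omega
  · rintro s' ⟨h0, n, D, hD, -⟩ v hv
    rw [eval_r] at h0
    rw [h0] at hD
    exact ⟨hD.rho_le v, hD.rho_eq_zero_iff hAC hv⟩

end AllCavity

/-! ### The output loop, and numberings of nodes and copies. -/

namespace AllCavity

open RAM

/-- The loop body that computes the output for one node. -/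
def outputNode : Cmd Reg Arr :=
  .sum ≔ 0 ;;
  forLoop .i (.get .height (r .v)) (
    .sum ≔ r .sum + .get .rho (.get .off (r .v) + r .i)) ;;
  .store .cav (r .v) (r .tot - r .sum)

theorem output_eq : output =
    (forLoop .e (r .m) (.ite (.get .em (r .e)) (.tot ≔ r .tot + .get .ew (r .e)) .skip) ;;
     forLoop .v (r .nx + r .ny) outputNode) := rfl

theorem outputNode_halts (s : State Reg Arr) :
    Halts outputNode s (1000 * (s.arr .height (s.reg .v) + 1)) fun s' => Frame outputNode s s' ∧
      s'.arr .cav = Function.update (s.arr .cav) (s.reg .v) (s.reg .tot -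
        ∑ i ∈ Finset.range (s.arr .height (s.reg .v)),
          s.arr .rho (s.arr .off (s.reg .v) + i)) := by
  refine Halts.frame (Q := fun s' : State Reg Arr =>
    s'.arr .cav = Function.update (s.arr .cav) (s.reg .v) (s.reg .tot -
        ∑ i ∈ Finset.range (s.arr .height (s.reg .v)),
          s.arr .rho (s.arr .off (s.reg .v) + i))) ?_
  rw [outputNode]
  refine Halts.mono ((Halts.of_loopFree (c := Cmd.assign Reg.sum 0) rfl s
    (Q := fun s' => s' = s.setReg .sum 0) rfl).seq fun s₁ h₁ =>
    (halts_forLoop (n := s.arr .height (s.reg .v)) (fun k s' => s'.reg .sum =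
      ∑ i ∈ Finset.range k, s.arr .rho (s.arr .off (s.reg .v) + i)) (fun _ => 100)
      ?_ ?_ ?_).seq fun s₂ ⟨hf, h₂⟩ => (Halts.of_loopFree rfl s₂ ?_).mono le_rfl fun s' h => h)
      ?_ fun s' h => h
  · simp [h₁]
  · intro j s' hf _
    simp [hf.1 .v rfl, hf.2 .height rfl, h₁]
  · intro j hj s' hf hI hj'
    refine (Halts.of_loopFree rfl s' (Q := fun s'' => s''.reg .i = j ∧ _) ?_).mono (by decide)
      fun s' h => h
    simp [Cmd.run, hj', hI, hf.1 .v rfl, hf.2 .rho rfl, hf.2 .off rfl, h₁, Finset.sum_range_succ]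
  · simp [Cmd.run, h₂, hf.1 .v rfl, hf.1 .tot rfl, hf.2 .cav rfl, h₁]
  · have h1 : (Expr.get .height (r .v) : Expr Reg Arr).cost = 2 := rfl
    have h2 : (.sum ≔ 0 : Cmd Reg Arr).bound = 2 := rfl
    have h3 : (.store .cav (r .v) (r .tot - r .sum) : Cmd Reg Arr).bound = 5 := rfl
    simp only [Finset.sum_const, Finset.card_range, smul_eq_mul, h1, h2, h3]
    omega

theorem output_halts (s : State Reg Arr) (htot : s.reg .tot = 0) :
    Halts output s (2000 * (s.reg .m + (s.reg .nx + s.reg .ny) +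
        ∑ v ∈ Finset.range (s.reg .nx + s.reg .ny), s.arr .height v + 1)) fun s' =>
      Frame output s s' ∧ ∀ v < s.reg .nx + s.reg .ny, s'.arr .cav v =
        (∑ j ∈ Finset.range (s.reg .m), if s.arr .em j ≠ 0 then s.arr .ew j else 0) -
          ∑ i ∈ Finset.range (s.arr .height v), s.arr .rho (s.arr .off v + i) := by
  refine Halts.frame (Q := fun s' : State Reg Arr =>
      ∀ v < s.reg .nx + s.reg .ny, s'.arr .cav v =
        (∑ j ∈ Finset.range (s.reg .m), if s.arr .em j ≠ 0 then s.arr .ew j else 0) -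
          ∑ i ∈ Finset.range (s.arr .height v), s.arr .rho (s.arr .off v + i)) ?_
  rw [output_eq]
  refine Halts.mono ((halts_forLoop (n := s.reg .m) (fun k s' => s'.reg .tot =
      ∑ j ∈ Finset.range k, if s.arr .em j ≠ 0 then s.arr .ew j else 0) (fun _ => 100)
      ?_ ?_ ?_).seq fun s₁ ⟨hf, h₁⟩ => (halts_forLoop (n := s.reg .nx + s.reg .ny)
      (fun k s' => ∀ v < k, s'.arr .cav v =
        (∑ j ∈ Finset.range (s.reg .m), if s.arr .em j ≠ 0 then s.arr .ew j else 0) -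
          ∑ i ∈ Finset.range (s.arr .height v), s.arr .rho (s.arr .off v + i))
      (fun v => 1000 * (s.arr .height v + 1)) ?_ ?_ ?_).mono le_rfl fun s' h => h.2)
      ?_ fun s' h => h
  · simp [htot]
  · intro j s' hf _
    exact hf.1 .m rfl
  · intro j hj s' hf hI hj'
    refine (Halts.of_loopFree rfl s' (Q := fun s'' => s''.reg .e = j ∧ _) ?_).mono (by decide)
      fun s' h => h
    simp only [Cmd.run, Expr.eval_get, eval_r, Expr.eval_add, hj', hI, hf.2 .em rfl, hf.2 .ew rfl,
      Finset.sum_range_succ]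
    split_ifs <;> simp_all
  · simp
  · intro j s' hf' _
    simp [hf'.1 .nx rfl, hf.1 .nx rfl, hf'.1 .ny rfl, hf.1 .ny rfl]
  · intro j hj s' hf' hI hj'
    have := outputNode_halts s'
    rw [hj', hf'.2 .height rfl, hf'.2 .rho rfl, hf'.2 .off rfl, hf'.1 .tot rfl,
      hf.2 .height rfl, hf.2 .rho rfl, hf.2 .off rfl, h₁] at this
    refine this.mono le_rfl fun s'' ⟨hf'', h''⟩ => ⟨(hf''.1 .v rfl).trans hj', fun v hv => ?_⟩
    rw [State.setReg_arr, h'']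
    rcases Nat.lt_succ_iff_lt_or_eq.1 hv with hv | rfl
    · rw [Function.update_of_ne hv.ne, hI v hv]
    · rw [Function.update_self]
  · have h1 : (r .nx + r .ny : Expr Reg Arr).cost = 3 := rfl
    have h2 : (r .m : Expr Reg Arr).cost = 1 := rfl
    simp only [Finset.sum_add_distrib, ← Finset.mul_sum, Finset.sum_const, Finset.card_range, smul_eq_mul, h1, h2]
    omega

/-! ### Numbers of nodes and of copies -/

theorem nodeNumber_lt {p q : ℕ} (u : Fin p ⊕ Fin q) : nodeNumber u < p + q := by
  rcases u with x | y <;> simp only [nodeNumber] <;> omega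

theorem nodeNumber_injective {p q : ℕ} :
    Function.Injective (nodeNumber : Fin p ⊕ Fin q → ℕ) := by
  rintro (x | y) (x' | y') h <;> simp only [nodeNumber] at h
  · rw [Fin.ext h]
  · omega
  · omega
  · rw [Fin.ext (by omega : (y : ℕ) = y')]

theorem exists_nodeNumber_eq {p q v : ℕ} (hv : v < p + q) :
    ∃ u : Fin p ⊕ Fin q, nodeNumber u = v := by
  by_cases h : v < p
  · exact ⟨.inl ⟨v, h⟩, rfl⟩
  · exact ⟨.inr ⟨v - p, by omega⟩, by simp only [nodeNumber]; omega⟩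

theorem sum_range_nodeNumber {p q : ℕ} (f : ℕ → ℕ) :
    ∑ v ∈ Finset.range (p + q), f v = ∑ u : Fin p ⊕ Fin q, f (nodeNumber u) := by
  rw [Finset.sum_range_add, Fintype.sum_sum_type, Finset.sum_range, Finset.sum_range]
  rfl

/-- With the next two lemmas: the intervals of numbers assigned to the nodes are consecutive,
disjoint and exhaust all numbers below the total. -/
theorem sum_range_add_lt {h : ℕ → ℕ} {v n i : ℕ} (hv : v < n) (hi : i < h v) :
    ∑ u ∈ Finset.range v, h u + i < ∑ u ∈ Finset.range n, h u := by
  calc ∑ u ∈ Finset.range v, h u + i < ∑ u ∈ Finset.range (v + 1), h u := by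
        rw [Finset.sum_range_succ]
        omega
    _ ≤ _ := Finset.sum_le_sum_of_subset (Finset.range_mono hv)

theorem sum_range_add_injective {h : ℕ → ℕ} {v v' i i' : ℕ} (hi : i < h v) (hi' : i' < h v')
    (he : ∑ u ∈ Finset.range v, h u + i = ∑ u ∈ Finset.range v', h u + i') : v = v' ∧ i = i' := by
  rcases lt_trichotomy v v' with hlt | rfl | hlt
  · have := sum_range_add_lt hlt hi
    omega
  · exact ⟨rfl, by omega⟩
  · have := sum_range_add_lt hlt hi'
    omega

theorem exists_sum_range_add_eq {h : ℕ → ℕ} {k : ℕ} :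
    ∀ {n : ℕ}, k < ∑ u ∈ Finset.range n, h u →
      ∃ v < n, ∃ i < h v, ∑ u ∈ Finset.range v, h u + i = k
  | 0, hk => by simp at hk
  | n + 1, hk => by
    rcases Nat.lt_or_ge k (∑ u ∈ Finset.range n, h u) with hlt | hge
    · obtain ⟨v, hv, h'⟩ := exists_sum_range_add_eq hlt
      exact ⟨v, by omega, h'⟩
    · rw [Finset.sum_range_succ] at hk
      exact ⟨n, by omega, k - ∑ u ∈ Finset.range n, h u, by omega, by omega⟩

theorem getD_map {α : Type} (l : List α) (f : α → ℕ) {j : ℕ} (hj : j < l.length) :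
    (l.map f).getD j 0 = f l[j] := by
  simp [List.getD, hj]

theorem sum_range_getD (l : List ℕ) : ∑ j ∈ Finset.range l.length, l.getD j 0 = l.sum := by
  induction l with
  | nil => rfl
  | cons k l ih =>
    rw [List.length_cons, Finset.sum_range_succ', List.sum_cons, ← ih, add_comm]
    rfl

theorem sum_range_getD_map {α : Type} [DecidableEq α] {l : List α} (hl : l.Nodup) (f : α → ℕ) :
    ∑ j ∈ Finset.range l.length, (l.map f).getD j 0 = ∑ e ∈ l.toFinset, f e := by
  rw [List.sum_toFinset f hl, ← sum_range_getD, List.length_map]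

theorem mem_of_lookup_eq_some {B : List (ℕ × ℕ)} {a b : ℕ} (h : B.lookup a = some b) :
    (a, b) ∈ B := by
  induction B with
  | nil => simp at h
  | cons e B ih =>
    obtain ⟨a', b'⟩ := e
    rw [lookup_cons_eq_ite] at h
    split_ifs at h with h'
    · obtain rfl := Option.some.inj h
      simp [h']
    · exact List.mem_cons_of_mem _ (ih h)

theorem exists_lookup_eq_some {B : List (ℕ × ℕ)} {a b : ℕ} (h : (a, b) ∈ B) :
    ∃ b', B.lookup a = some b' := by
  induction B with
  | nil => simp at h
  | cons e B ih =>
    obtain ⟨a', b'⟩ := e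
    rw [lookup_cons_eq_ite]
    split_ifs with h'
    · exact ⟨_, rfl⟩
    · refine ih ((List.mem_cons.1 h).resolve_left fun he => h' ?_)
      rw [(Prod.mk.inj he).1]

end AllCavity

namespace WBGraph

theorem setWeight_eq_sum {X Y : Type*} [DecidableEq X] [DecidableEq Y] {G : WBGraph X Y}
    {M : Finset (X × Y)} {S : Finset (X × Y)} (h : M ⊆ S) :
    G.setWeight M = ∑ e ∈ S, if e ∈ M then G.weight e.1 e.2 else 0 := by
  rw [← Finset.sum_filter, Finset.filter_mem_eq_inter, Finset.inter_eq_right.2 h, setWeight]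

theorem totalWeight_eq_sum {X Y : Type*} [Fintype X] [Fintype Y] {G : WBGraph X Y}
    {S : Finset (X × Y)} (h : ∀ e, e ∈ S ↔ 0 < G.weight e.1 e.2) :
    G.totalWeight = ∑ e ∈ S, G.weight e.1 e.2 := by
  rw [totalWeight, ← Fintype.sum_prod_type']
  refine (Finset.sum_subset (Finset.subset_univ S) fun e _ he => ?_).symm
  rw [h] at he
  omega

/-- The heaviest edge at a node weighs at most the sum of all edges there, and each edge is summed
at its two ends. This bounds the number of copies. -/
theorem sum_heaviest_le {X Y : Type*} [Fintype X] [Fintype Y] (G : WBGraph X Y) :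
    ∑ u, G.heaviest u ≤ 2 * G.totalWeight := by
  have h : ∀ u, G.heaviest u ≤ ∑ v, G.nodeWeight u v := fun u =>
    Finset.sup_le fun v hv =>
      Finset.single_le_sum (f := G.nodeWeight u) (fun _ _ => Nat.zero_le _) hv
  refine (Finset.sum_le_sum fun u _ => h u).trans (le_of_eq ?_)
  simp only [Fintype.sum_sum_type, nodeWeight, Finset.sum_const_zero, zero_add, add_zero]
  rw [Finset.sum_comm (f := fun y x => G.weight x y), two_mul]
  rfl

end WBGraph

/-! ### Translation between numbers in memory and copies in the unfolded graph. -/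

namespace AllCavity

open RAM WBGraph

section Numbering

variable {p q : ℕ} {G : WBGraph (Fin p) (Fin q)} {h off : ℕ → ℕ}

/-- The number of a copy. -/
def copyNumber (off : ℕ → ℕ) (a : G.Copy) : ℕ := off (nodeNumber a.1) + a.2

theorem copyNumber_lt (hh : ∀ u : Fin p ⊕ Fin q, h (nodeNumber u) = G.heaviest u)
    (hoff : ∀ v ≤ p + q, off v = ∑ u ∈ Finset.range v, h u) (a : G.Copy) :
    copyNumber off a < off (p + q) := by
  have := nodeNumber_lt a.1
  rw [copyNumber, hoff _ this.le, hoff _ le_rfl]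
  exact sum_range_add_lt this (by rw [hh]; exact a.2.2)

theorem copyNumber_injective (hh : ∀ u : Fin p ⊕ Fin q, h (nodeNumber u) = G.heaviest u)
    (hoff : ∀ v ≤ p + q, off v = ∑ u ∈ Finset.range v, h u) :
    Function.Injective (copyNumber off : G.Copy → ℕ) := by
  intro a b hab
  rw [copyNumber, copyNumber, hoff _ (nodeNumber_lt _).le, hoff _ (nodeNumber_lt _).le] at hab
  obtain ⟨h1, h2⟩ := sum_range_add_injective (by rw [hh]; exact a.2.2) (by rw [hh]; exact b.2.2) hab
  exact copy_ext (nodeNumber_injective h1) h2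

theorem exists_copyNumber_eq (hh : ∀ u : Fin p ⊕ Fin q, h (nodeNumber u) = G.heaviest u)
    (hoff : ∀ v ≤ p + q, off v = ∑ u ∈ Finset.range v, h u) {k : ℕ} (hk : k < off (p + q)) :
    ∃ a : G.Copy, copyNumber off a = k := by
  rw [hoff _ le_rfl] at hk
  obtain ⟨v, hv, i, hi, rfl⟩ := exists_sum_range_add_eq hk
  obtain ⟨u, rfl⟩ := exists_nodeNumber_eq hv
  rw [hh] at hi
  exact ⟨⟨u, ⟨i, hi⟩⟩, by rw [copyNumber, hoff _ hv.le]⟩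

/-- The arcs that the procedure constructs are the edges of the unfolded graph. -/
theorem mem_edgeArcs_iff {l : List (Fin p × Fin q)} {x y w : ℕ → ℕ} {P : ℕ → Prop}
    [DecidablePred P] {S : Finset (Fin p × Fin q)}
    (hx : ∀ j (hj : j < l.length), x j = off (l[j].1 : ℕ))
    (hy : ∀ j (hj : j < l.length), y j = off (p + (l[j].2 : ℕ)))
    (hw : ∀ j (hj : j < l.length), w j = G.weight l[j].1 l[j].2)
    (hP : ∀ j (hj : j < l.length), P j ↔ l[j] ∈ S)
    (hl : ∀ e ∈ S, e ∈ l) {k k' : ℕ} :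
    (k, k') ∈ edgeArcs x y w P l.length ↔ ∃ a b : G.Copy, copyNumber off a = k ∧
      copyNumber off b = k' ∧ G.unfold.Adj a b ∧ Joins S a.1 b.1 := by
  rw [mem_edgeArcs]
  constructor
  · rintro ⟨j, hj, hPj, hk⟩
    rw [hP j hj] at hPj
    obtain ⟨i, hi, hk⟩ := mem_copyArcs.1 hk
    rw [hx j hj, hy j hj, hw j hj] at hk
    rw [hw j hj] at hi
    generalize l[j] = e at hPj hk hi
    obtain ⟨u, v⟩ := e
    dsimp only at hk hi
    have h1 : G.weight u v ≤ G.heaviest (.inl u) := G.nodeWeight_le_heaviest (.inl u) (.inr v)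
    have h2 : G.weight u v ≤ G.heaviest (.inr v) := G.nodeWeight_le_heaviest (.inr v) (.inl u)
    let a : G.Copy := ⟨.inl u, ⟨i, by omega⟩⟩
    let b : G.Copy := ⟨.inr v, ⟨G.weight u v - (i + 1), by omega⟩⟩
    have hab : G.unfold.Adj a b := by
      change i + (G.weight u v - (i + 1)) + 1 = G.weight u v
      omega
    rcases hk with ⟨rfl, rfl⟩ | ⟨rfl, rfl⟩
    · exact ⟨a, b, rfl, rfl, hab, hPj⟩
    · exact ⟨b, a, rfl, rfl, hab.symm, hPj⟩
  · rintro ⟨⟨u, i⟩, ⟨v, i'⟩, rfl, rfl, hab, hS⟩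
    have hab' : (i : ℕ) + i' + 1 = G.nodeWeight u v := hab
    rcases u with u | u <;> rcases v with v | v <;> simp only [Joins] at hS <;>
      simp only [nodeWeight] at hab' <;>
      obtain ⟨j, hj, hlj⟩ := List.mem_iff_getElem.1 (hl _ hS) <;>
      refine ⟨j, hj, (hP j hj).2 (by rwa [hlj]), ?_⟩ <;>
      rw [mem_copyArcs, hx j hj, hy j hj, hw j hj, hlj]
    · refine ⟨i, by dsimp only; omega, .inl ⟨rfl, ?_⟩⟩
      simp only [copyNumber, nodeNumber]
      omega
    · refine ⟨i', by dsimp only; omega, .inr ⟨rfl, ?_⟩⟩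
      simp only [copyNumber, nodeNumber]
      omega

/-- It does not matter which entry `lookup` finds, since the unfolded matching allows only one
partner. The shift by one keeps 0 free for unmatched nodes. -/
theorem mate_eq_succ_iff {M : Finset (Fin p × Fin q)} (hM : G.IsMatching M)
    (hinj : Function.Injective (copyNumber off : G.Copy → ℕ)) {B : List (ℕ × ℕ)} {mate : ℕ → ℕ}
    (hmate : ∀ k, mate k = ((B.lookup k).map (· + 1)).getD 0)
    (hB : ∀ k k', (k, k') ∈ B ↔ ∃ a b : G.Copy, copyNumber off a = k ∧
      copyNumber off b = k' ∧ s(a, b) ∈ G.unfoldEdges M) {k k' : ℕ} :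
    mate k = k' + 1 ↔ ∃ a b : G.Copy, copyNumber off a = k ∧ copyNumber off b = k' ∧
      s(a, b) ∈ G.unfoldEdges M := by
  have hmem : ∀ {k₁}, B.lookup k = some k₁ → ∃ a b : G.Copy, copyNumber off a = k ∧
      copyNumber off b = k₁ ∧ s(a, b) ∈ G.unfoldEdges M := fun h =>
    (hB _ _).1 (mem_of_lookup_eq_some h)
  rw [hmate]
  constructor
  · intro h
    cases hk : B.lookup k with
    | none => simp [hk] at h
    | some k₁ =>
      obtain rfl : k₁ = k' := by simpa [hk] using h
      exact hmem hk
  · rintro ⟨a, b, rfl, rfl, hab⟩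
    obtain ⟨k₁, hk₁⟩ := exists_lookup_eq_some ((hB _ _).2 ⟨a, b, rfl, rfl, hab⟩)
    obtain ⟨a', b', ha, rfl, hab'⟩ := hmem hk₁
    rw [hinj ha] at hab'
    rw [hk₁, hM.unfoldEdges_unique hab hab']
    rfl

/-- The numbering is a bijection that carries arcs to edges and mates to matched edges, so both
inductive closures correspond rule by rule. -/
theorem marked_iff {M : Finset (Fin p × Fin q)} {A : List (ℕ × ℕ)} {mate : ℕ → ℕ} {C : ℕ}
    (hinj : Function.Injective (copyNumber off : G.Copy → ℕ))
    (hlt : ∀ a : G.Copy, copyNumber off a < C)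
    (hsurj : ∀ k < C, ∃ a : G.Copy, copyNumber off a = k)
    (hA : ∀ k k', (k, k') ∈ A ↔ ∃ a b : G.Copy, copyNumber off a = k ∧
      copyNumber off b = k' ∧ G.unfold.Adj a b)
    (hmate : ∀ k k', mate k = k' + 1 ↔ ∃ a b : G.Copy, copyNumber off a = k ∧
      copyNumber off b = k' ∧ s(a, b) ∈ G.unfoldEdges M) (a : G.Copy) :
    Marked A mate C (copyNumber off a) ↔ EvenReachable G M a := by
  constructor
  · suffices ∀ k, Marked A mate C k → ∃ a : G.Copy, copyNumber off a = k ∧ EvenReachable G M a by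
      intro h
      obtain ⟨b, hb, hr⟩ := this _ h
      rwa [← hinj hb]
    intro k hk
    induction hk with
    | @unmatched k hk h0 =>
      obtain ⟨a, rfl⟩ := hsurj k hk
      refine ⟨a, rfl, .unmatched fun hm => ?_⟩
      obtain ⟨b, hb⟩ := matchedBy_unfoldEdges.1 hm
      rw [(hmate _ _).2 ⟨a, b, rfl, rfl, hb⟩] at h0
      exact Nat.succ_ne_zero _ h0
    | @step k k' k'' _ h1 h2 ih =>
      obtain ⟨a, rfl, ha⟩ := ih
      obtain ⟨a', b, ha', rfl, hab⟩ := (hA _ _).1 h1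
      rw [hinj ha'] at hab
      obtain ⟨b', c, hb', rfl, hbc⟩ := (hmate _ _).1 h2
      rw [hinj hb'] at hbc
      exact ⟨c, rfl, .step ha hab hbc⟩
  · intro h
    induction h with
    | @unmatched a hm =>
      refine .unmatched (hlt a) ?_
      by_contra h0
      obtain ⟨k, hk⟩ := Nat.exists_eq_succ_of_ne_zero h0
      obtain ⟨a', b, ha', -, hab⟩ := (hmate _ _).1 hk
      rw [hinj ha'] at hab
      exact hm (matchedBy_unfoldEdges.2 ⟨b, hab⟩)
    | @step a b c _ hab hbc ih =>
      exact .step ih ((hA _ _).2 ⟨a, b, rfl, rfl, hab⟩) ((hmate _ _).2 ⟨b, c, rfl, rfl, hbc⟩)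

/-- The heights that the procedure computes. -/
theorem sup_eq_heaviest {l : List (Fin p × Fin q)} {x y w : ℕ → ℕ}
    (hmem : ∀ e, e ∈ l ↔ 0 < G.weight e.1 e.2)
    (hx : ∀ j (hj : j < l.length), x j = (l[j].1 : ℕ))
    (hy : ∀ j (hj : j < l.length), y j = (l[j].2 : ℕ))
    (hw : ∀ j (hj : j < l.length), w j = G.weight l[j].1 l[j].2) (u : Fin p ⊕ Fin q) :
    ((Finset.range l.length).sup fun j =>
      if x j = nodeNumber u ∨ p + y j = nodeNumber u then w j else 0) = G.heaviest u := by
  refine le_antisymm (Finset.sup_le fun j hj => ?_) (Finset.sup_le fun v _ => ?_)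
  · rw [Finset.mem_range] at hj
    rw [hx j hj, hy j hj, hw j hj]
    generalize l[j] = e
    obtain ⟨x', y'⟩ := e
    split_ifs with h
    · rcases h with h | h
      · obtain rfl : Sum.inl x' = u := nodeNumber_injective h
        exact G.nodeWeight_le_heaviest (.inl x') (.inr y')
      · obtain rfl : Sum.inr y' = u := nodeNumber_injective h
        exact G.nodeWeight_le_heaviest (.inr y') (.inl x')
    · exact Nat.zero_le _
  · rcases Nat.eq_zero_or_pos (G.nodeWeight u v) with h0 | hpos
    · exact h0.trans_le (Nat.zero_le _)
    · obtain ⟨e, he, huv⟩ : ∃ e : Fin p × Fin q, G.weight e.1 e.2 = G.nodeWeight u v ∧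
          (u = .inl e.1 ∨ u = .inr e.2) := by
        rcases u with u | u <;> rcases v with v | v <;> simp only [nodeWeight] at hpos ⊢
        · omega
        · exact ⟨(u, v), rfl, .inl rfl⟩
        · exact ⟨(v, u), rfl, .inr rfl⟩
        · omega
      obtain ⟨j, hj, rfl⟩ := List.mem_iff_getElem.1 ((hmem e).2 (he ▸ hpos))
      refine le_trans (le_of_eq ?_) (Finset.le_sup (Finset.mem_range.2 hj))
      rw [hx j hj, hy j hj, hw j hj, if_pos, he]
      rcases huv with rfl | rfl
      · exact .inl rfl
      · exact .inr rfl

end Numbering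

end AllCavity

/-! ### The whole procedure, and the bound O(W). -/

namespace AllCavity

open RAM WBGraph

theorem computeAllCavity_halts {p q : ℕ} {G : WBGraph (Fin p) (Fin q)} {l : List (Fin p × Fin q)}
    {M : Finset (Fin p × Fin q)} (hl : l.Nodup) (hmem : ∀ e, e ∈ l ↔ 0 < G.weight e.1 e.2)
    (hM : G.IsMaxWeightMatching M) :
    Halts computeAllCavity (input G l M)
      (30000 * (l.length + (p + q) + G.totalWeight + 1)) fun s =>
      (∀ (u : Fin p ⊕ Fin q) (i : Fin (G.heaviest u)),
        s.arr .rho (s.arr .off (nodeNumber u) + i) = G.rho M ⟨u, i⟩) ∧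
      ∀ u : Fin p ⊕ Fin q, s.arr .cav (nodeNumber u) = (G.deleteNode u).mwm := by
  set s₀ := input G l M with hs₀
  have ex : ∀ j (hj : j < l.length), s₀.arr .ex j = (l[j].1 : ℕ) := fun j hj => getD_map l _ hj
  have ey : ∀ j (hj : j < l.length), s₀.arr .ey j = (l[j].2 : ℕ) := fun j hj => getD_map l _ hj
  have ew : ∀ j (hj : j < l.length), s₀.arr .ew j = G.weight l[j].1 l[j].2 :=
    fun j hj => getD_map l _ hj
  have em : ∀ j (hj : j < l.length), s₀.arr .em j ≠ 0 ↔ l[j] ∈ M := by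
    intro j hj
    rw [show s₀.arr .em j = _ from getD_map l _ hj]
    simp
  have hlM : ∀ e ∈ M, e ∈ l := fun e he => (hmem e).2 (hM.1.1 e he)
  have hsumw : ∑ j ∈ Finset.range l.length, s₀.arr .ew j = G.totalWeight := by
    rw [totalWeight_eq_sum (S := l.toFinset) (by simpa using hmem), ← sum_range_getD_map hl]
    rfl
  have hsumM : (∑ j ∈ Finset.range l.length, if s₀.arr .em j ≠ 0 then s₀.arr .ew j else 0) =
      G.setWeight M := by
    rw [setWeight_eq_sum (S := l.toFinset) (fun e he => by simpa using hlM e he),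
      ← sum_range_getD_map hl]
    refine Finset.sum_congr rfl fun j hj => ?_
    rw [Finset.mem_range] at hj
    rw [getD_map l _ hj, ew j hj]
    simp only [em j hj]
  have hu := unfoldGraph_halts s₀ (fun _ => rfl) rfl rfl (fun _ => rfl) (fun _ => rfl)
  change Halts _ _ (4000 * (l.length + (p + q) + ∑ j ∈ Finset.range l.length, s₀.arr .ew j + 1))
    _ at hu
  rw [hsumw] at hu
  -- The search has C ≤ 2W nodes and 2W arcs, two for each of the W unfolded edges; the output loop
  -- visits at most 2W copies.
  refine (hu.seq (T₂ := 4000 * (4 * G.totalWeight + 1) +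
    2000 * (l.length + (p + q) + 2 * G.totalWeight + 1))
    fun s₁ ⟨f₁, hheight, hoff, harcs, hmates⟩ => ?_).mono (by omega) fun s h => h
  change ∀ v, s₁.arr .height v = (Finset.range l.length).sup fun j =>
    if s₀.arr .ex j = v ∨ p + s₀.arr .ey j = v then s₀.arr .ew j else 0 at hheight
  change ∀ v ≤ p + q, s₁.arr .off v = ∑ u ∈ Finset.range v, s₁.arr .height u at hoff
  have hh : ∀ u : Fin p ⊕ Fin q, s₁.arr .height (nodeNumber u) = G.heaviest u := fun u =>
    (hheight _).trans (sup_eq_heaviest hmem ex ey ew u)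
  have hinj : Function.Injective (copyNumber (s₁.arr .off) : G.Copy → ℕ) :=
    copyNumber_injective hh hoff
  have hC : s₁.arr .off (p + q) ≤ 2 * G.totalWeight := by
    rw [hoff _ le_rfl, sum_range_nodeNumber, Finset.sum_congr rfl fun u _ => hh u]
    exact G.sum_heaviest_le
  set A := edgeArcs (fun j => s₁.arr .off (s₀.arr .ex j))
    (fun j => s₁.arr .off (s₀.reg .nx + s₀.arr .ey j)) (s₀.arr .ew) (fun _ => True) (s₀.reg .m)
    with hA
  set B := edgeArcs (fun j => s₁.arr .off (s₀.arr .ex j))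
    (fun j => s₁.arr .off (s₀.reg .nx + s₀.arr .ey j)) (s₀.arr .ew) (fun j => s₀.arr .em j ≠ 0)
    (s₀.reg .m) with hB
  have hAlen : A.length = 2 * G.totalWeight := (length_edgeArcs _ _ _ _).trans (by rw [← hsumw]; rfl)
  have hxo : ∀ j (hj : j < l.length), s₁.arr .off (s₀.arr .ex j) = s₁.arr .off (l[j].1 : ℕ) :=
    fun j hj => by rw [ex j hj]
  have hyo : ∀ j (hj : j < l.length), s₁.arr .off (s₀.reg .nx + s₀.arr .ey j) =
    s₁.arr .off (p + (l[j].2 : ℕ)) := fun j hj => by rw [ey j hj]; rfl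
  have hAmem : ∀ k k', (k, k') ∈ A ↔ ∃ a b : G.Copy, copyNumber (s₁.arr .off) a = k ∧
      copyNumber (s₁.arr .off) b = k' ∧ G.unfold.Adj a b := by
    intro k k'
    -- With all edges of `G` as `S`, the condition `Joins` already follows from adjacency.
    refine (mem_edgeArcs_iff (G := G) (S := l.toFinset) hxo hyo ew (by simp) (by simp)).trans ?_
    refine exists_congr fun a => exists_congr fun b => and_congr_right fun _ =>
      and_congr_right fun _ => and_iff_left_of_imp fun hab => ?_
    have hab' : (a.2 : ℕ) + b.2 + 1 = G.nodeWeight a.1 b.1 := hab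
    have hpos : 0 < G.nodeWeight a.1 b.1 := hab' ▸ Nat.succ_pos _
    revert hpos
    generalize a.1 = u
    generalize b.1 = v
    intro hpos
    rcases u with u | u <;> rcases v with v | v <;> simp only [nodeWeight] at hpos <;>
      simp only [Joins, List.mem_toFinset, hmem]
    · exact absurd hpos (lt_irrefl 0)
    · exact hpos
    · exact hpos
    · exact absurd hpos (lt_irrefl 0)
  have hBmem : ∀ k k', (k, k') ∈ B ↔ ∃ a b : G.Copy, copyNumber (s₁.arr .off) a = k ∧
      copyNumber (s₁.arr .off) b = k' ∧ s(a, b) ∈ G.unfoldEdges M := by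
    intro k k'
    simp only [mem_unfoldEdges]
    exact mem_edgeArcs_iff hxo hyo ew em hlM
  have hmate : ∀ k k', s₁.arr .mate k = k' + 1 ↔ ∃ a b : G.Copy, copyNumber (s₁.arr .off) a = k ∧
      copyNumber (s₁.arr .off) b = k' ∧ s(a, b) ∈ G.unfoldEdges M := fun k k' =>
    mate_eq_succ_iff hM.1 hinj hmates hBmem
  have hnx : s₁.reg .nx = p := f₁.1 .nx rfl
  have hny : s₁.reg .ny = q := f₁.1 .ny rfl
  have hsearch := search_halts (s := s₁) (C := s₁.arr .off (p + q)) (by rw [hnx, hny]) harcs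
    (by
      rintro ⟨k, k'⟩ hk
      obtain ⟨a, -, rfl, -⟩ := (hAmem k k').1 hk
      exact copyNumber_lt hh hoff a)
    (fun v => by rw [f₁.2 .rho rfl]; rfl) (f₁.1 .sp rfl)
    (fun b c hbc => by
      obtain ⟨-, c, -, rfl, -⟩ := (hmate b c).1 hbc
      exact copyNumber_lt hh hoff c)
  refine (hsearch.mono (T' := 4000 * (4 * G.totalWeight + 1)) (by omega) fun s h => h).seq
    fun s₂ ⟨f₂, hrho⟩ => ?_
  have hrho' : ∀ a : G.Copy, s₂.arr .rho (copyNumber (s₁.arr .off) a) = G.rho M a := by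
    intro a
    have h1 := hrho _ (copyNumber_lt hh hoff a)
    rw [marked_iff hinj (copyNumber_lt hh hoff) (fun k hk => exists_copyNumber_eq hh hoff hk)
      hAmem hmate, ← rho_eq_zero_iff hM.1] at h1
    have h2 := rho_le_one (M := M) a
    omega
  have hout := output_halts s₂ ((f₂.1 .tot rfl).trans (f₁.1 .tot rfl))
  have e1 : s₂.reg .m = l.length := (f₂.1 .m rfl).trans (f₁.1 .m rfl)
  have e2 : s₂.arr .em = s₀.arr .em := (f₂.2 .em rfl).trans (f₁.2 .em rfl)
  have e3 : s₂.arr .ew = s₀.arr .ew := (f₂.2 .ew rfl).trans (f₁.2 .ew rfl)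
  rw [e1, e2, e3, hsumM, f₂.1 .nx rfl, f₂.1 .ny rfl, hnx, hny, f₂.2 .height rfl, f₂.2 .off rfl,
    ← hoff _ le_rfl] at hout
  refine hout.mono (by omega) fun s ⟨f₃, hcav⟩ => ⟨fun u i => ?_, fun u => ?_⟩
  · rw [f₃.2 .rho rfl, f₃.2 .off rfl, f₂.2 .off rfl]
    exact hrho' ⟨u, i⟩
  · have hsum : ∑ i : Fin (G.heaviest u), s₂.arr .rho (s₁.arr .off (nodeNumber u) + i) =
        ∑ i, G.rho M ⟨u, i⟩ := Finset.sum_congr rfl fun i _ => hrho' ⟨u, i⟩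
    -- The truncated subtraction is exact, because the weight of `M` is mwm(G-u) plus the sum of ρ.
    rw [hcav _ (nodeNumber_lt u), hh, Finset.sum_range, hsum, ← mwm_deleteNode_add_sum_rho hM u,
      Nat.add_sub_cancel]

end AllCavity

theorem theorem4p3 (a : ℕ) :
    ∃ κ : ℕ, ∀ (p q : ℕ) (G : WBGraph (Fin p) (Fin q)) (l : List (Fin p × Fin q))
      (M : Finset (Fin p × Fin q)),
      l.Nodup → (∀ e, e ∈ l ↔ 0 < G.weight e.1 e.2) →
      0 < p + q → p + q ≤ a * l.length →
      G.IsMaxWeightMatching M →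
      ∃ (s : RAM.State AllCavity.Reg AllCavity.Arr) (t : ℕ),
        RAM.Exec AllCavity.computeAllCavity (AllCavity.input G l M) s t ∧
        t ≤ κ * G.totalWeight ∧
        (∀ (u : Fin p ⊕ Fin q) (i : Fin (G.heaviest u)),
          s.arr .rho (s.arr .off (AllCavity.nodeNumber u) + i) = G.rho M ⟨u, i⟩) ∧
        ∀ u : Fin p ⊕ Fin q,
          s.arr .cav (AllCavity.nodeNumber u) = (G.deleteNode u).mwm := by
  -- With m ≤ W, n ≤ a m ≤ a W and 1 ≤ m ≤ W, the sum m + n + W + 1 is at most (a + 3) W.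
  refine ⟨30000 * (a + 3), fun p q G l M hl hmem hpos hn hM => ?_⟩
  obtain ⟨s, t, h1, h2, h3⟩ := AllCavity.computeAllCavity_halts hl hmem hM
  refine ⟨s, t, h1, h2.trans ?_, h3⟩
  have hlen : l.length ≤ G.totalWeight := by
    rw [WBGraph.totalWeight_eq_sum (S := l.toFinset) (by simpa using hmem),
      ← List.toFinset_card_of_nodup hl, Finset.card_eq_sum_ones]
    exact Finset.sum_le_sum fun e he => (hmem e).1 (List.mem_toFinset.1 he)
  -- Being nonempty, a graph with n ≤ a m has an edge, and this absorbs the additive constant into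
  -- W.
  have h0 : 0 < l.length := by
    rcases Nat.eq_zero_or_pos l.length with h | h
    · rw [h] at hn
      omega
    · exact h
  have h4 := Nat.mul_le_mul_left a hlen
  rw [mul_assoc]
  refine Nat.mul_le_mul_left _ ?_
  rw [add_mul]
  omega
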